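/- **Setting.** Let $1\le s_1\le d_1$ and $1\le s_2\le d_2$ be integers and $\mu>0$. One observes $\mathbf Y=\mathbf X+\mathbf E\in\mathbb R^{d_1\times d_2}$, where $\mathbf E$ has i.i.d. $N(0,1)$ entries; $\mathbb P_{\mathbf X}$ is the law of $\mathbf Y$. Let $\Theta(s_1,s_2,d_1,d_2,\mu)$ be the set of matrices $\mathbf M$ for which there are $S_1\subseteq[d_1]$, $S_2\subseteq[d_2]$ with $|S_1|=s_1$, $|S_2|=s_2$, $\mathbf M_{ij}\ge\mu$ on $S_1\times S_2$ and $\mathbf M_{ij}=0$ elsewhere. For a test (a measurable $\{0,1\}$-valued function of $\mathbf Y$) put $$\mathcal R(\Delta,\mu)=\mathbb P_0(\Delta=1)+\sup_{\mathbf X\in\Theta(s_1,s_2,d_1,d_2,\mu)}\mathbb P_{\mathbf X}(\Delta=0).$$ **Rates.** Let $$\psi(s_1,s_2,d_1,d_2)=\tfrac1{s_1}\log\Big(1+\tfrac{d_2}{s_2^2}\log\big(e\tbinom{d_1}{s_1}\big)\Big),\qquad \phi(s_1,s_2,d_1,d_2)=\tfrac{d_1}{s_1^2}\log\Big(1+\tfrac{d_2}{s_2^2}\Big),$$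 $$\beta(s_1,s_2,d_1,d_2)=\tfrac1{s_1s_2}\log\tbinom{d_2}{s_2}\,\mathbf 1\Big\{\tfrac{d_1}{s_1^2}\log\big(e\tbinom{d_2}{s_2}\big)>1\Big\},$$ and for $f\in\{\psi,\phi,\beta\}$ write $f_{12}=f(s_1,s_2,d_1,d_2)$, $f_{21}=f(s_2,s_1,d_2,d_1)$. Let $$\tilde R=(\psi_{12}+\beta_{21})\wedge(\psi_{21}+\beta_{12})\wedge\phi_{12}\wedge\phi_{21}.$$ **Tests.** For $Z\sim N(0,1)$ and $\tau>0$ let $\nu_\tau=\mathbb E[Z^2\mid|Z|>\tau]$ and $g_\tau(y)=(y^2-\nu_\tau)\mathbf 1\{|y|>\tau\}$. For nonempty $J\subseteq[d_1]$ let $\bar{\mathbf Y}_{J,j}=|J|^{-1/2}\sum_{i\in J}\mathbf Y_{ij}$. For $K>0$ let $\tau=\sqrt{K\log(1+d_2/s_2^2)}$ and $\tau'=\sqrt{K\log(1+\frac{d_2}{s_2^2}\log(e\binom{d_1}{s_1}))}$, and define $$t_{\mathrm{lin}}=\frac1{\sqrt{d_1d_2}}\sum_{i,j}\mathbf Y_{ij},\qquad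 t_{\chi,1}=\sum_{j=1}^{d_2}g_\tau(\bar{\mathbf Y}_{[d_1],j}),$$ $$t_{\mathrm{max\text{-}lin},1}=\max_{|J|=s_1}\frac1{\sqrt{d_2}}\sum_{j=1}^{d_2}\bar{\mathbf Y}_{J,j},\qquad t_{\mathrm{max\text{-}}\chi,1}=\max_{|J|=s_1}\sum_{j=1}^{d_2}g_{\tau'}(\bar{\mathbf Y}_{J,j}).$$ The statistics with index $2$ are those with index $1$ for the transposed matrix, with $(s_1,d_1)$ and $(s_2,d_2)$ exchanged everywhere. Given cutoffs $h_1,h_1',h_2,h_2',h_3,h_3',h_4,h_4'>0$, let - $\Delta_a=\mathbf 1\{t_{\chi,1}>h_1\}$ if $d_2/s_2^2\ge1$, and $\Delta_a=\mathbf 1\{t_{\mathrm{lin}}>h_2\}$ otherwise; - $\Delta_b=\mathbf 1\{t_{\chi,2}>h_1'\}$ if $d_1/s_1^2\ge1$, and $\Delta_b=\mathbf 1\{t_{\mathrm{lin}}>h_2'\}$ otherwise; - $\Delta_c=\mathbf 1\{t_{\mathrm{max\text{-}}\chi,1}>h_3\}$ if $\frac{d_2}{s_2^2}\log(e\binom{d_1}{s_1})\ge1$,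 and $\Delta_c=\mathbf 1\{t_{\mathrm{max\text{-}lin},1}>h_4\}$ otherwise; - $\Delta_d=\mathbf 1\{t_{\mathrm{max\text{-}}\chi,2}>h_3'\}$ if $\frac{d_1}{s_1^2}\log(e\binom{d_2}{s_2})\ge1$, and $\Delta_d=\mathbf 1\{t_{\mathrm{max\text{-}lin},2}>h_4'\}$ otherwise. Let $\Delta^*$ be $\Delta_a$ if $\tilde R=\phi_{12}$, $\Delta_b$ if $\tilde R=\phi_{21}$, $\Delta_c$ if $\tilde R=\psi_{12}+\beta_{21}$, and $\Delta_d$ if $\tilde R=\psi_{21}+\beta_{12}$ (the first applicable case in this order). **Proposition.** There is an absolute constant $K>0$ such that for every $\eta\in(0,1)$ there are constants $C,C_{h_1},C_{h_1'},C_{h_2},C_{h_3},C_{h_3'},C_{h_4},C_{h_4'}>0$, depending only on $\eta$, such that for all $s_1,s_2,d_1,d_2,\mu$ as above: if $$\mu^2\ge C\big[(\psi_{12}+\psi_{21})\wedge\phi_{12}\wedge\phi_{21}\big],$$ then $\Delta^*$ with this $K$ and with the cutoffs $$h_1=C_{h_1}s_2\log\big(1+\tfrac{d_2}{s_2^2}\big),\qquad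 h_1'=C_{h_1'}s_1\log\big(1+\tfrac{d_1}{s_1^2}\big),\qquad h_2=h_2'=C_{h_2},$$ $$h_3=C_{h_3}\Big(s_2\log\big(1+\tfrac{d_2}{s_2^2}\log(e\tbinom{d_1}{s_1})\big)+\log(e\tbinom{d_1}{s_1})\Big),$$ $$h_3'=C_{h_3'}\Big(s_1\log\big(1+\tfrac{d_1}{s_1^2}\log(e\tbinom{d_2}{s_2})\big)+\log(e\tbinom{d_2}{s_2})\Big),$$ $$h_4=C_{h_4}\sqrt{\log(e\tbinom{d_1}{s_1})},\qquad h_4'=C_{h_4'}\sqrt{\log(e\tbinom{d_2}{s_2})}$$ is a test and satisfies $\mathcal R(\Delta^*,\mu)\le\eta$. -/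

import Mathlib

open MeasureTheory ProbabilityTheory
open scoped Matrix ENNReal

noncomputable section

namespace SubmatrixDetection

/-! ### The model, the alternatives and the risk -/

/-- The product (Borel) sigma-algebra on real matrices. -/
instance matrixMeasurableSpace (d₁ d₂ : ℕ) : MeasurableSpace (Matrix (Fin d₁) (Fin d₂) ℝ) :=
  inferInstanceAs (MeasurableSpace (Fin d₁ → Fin d₂ → ℝ))

/-- The law of the noise matrix: independent standard normal entries. -/
def noiseLaw (d₁ d₂ : ℕ) : Measure (Matrix (Fin d₁) (Fin d₂) ℝ) :=
  Measure.pi fun _ : Fin d₁ => Measure.pi fun _ : Fin d₂ => gaussianReal 0 1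

/-- The law of the observation `Y = X + E` with mean matrix `X`. -/
def obsLaw {d₁ d₂ : ℕ} (X : Matrix (Fin d₁) (Fin d₂) ℝ) : Measure (Matrix (Fin d₁) (Fin d₂) ℝ) :=
  (noiseLaw d₁ d₂).map fun E => X + E

/-- Mean matrices that vanish off `S₁ × S₂` and are at least `μ` on `S₁ × S₂`. -/
def ThetaOn {d₁ d₂ : ℕ} (S₁ : Finset (Fin d₁)) (S₂ : Finset (Fin d₂)) (μ : ℝ) :
    Set (Matrix (Fin d₁) (Fin d₂) ℝ) :=
  {M | (∀ i j, i ∈ S₁ ∧ j ∈ S₂ → μ ≤ M i j) ∧ (∀ i j, ¬ (i ∈ S₁ ∧ j ∈ S₂) → M i j = 0)}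

/-- The parameter set of the alternative: the union of `ThetaOn S₁ S₂ μ` over all `S₁`, `S₂` with
`s₁` and `s₂` elements. -/
def Theta (s₁ s₂ d₁ d₂ : ℕ) (μ : ℝ) : Set (Matrix (Fin d₁) (Fin d₂) ℝ) :=
  {M | ∃ (S₁ : Finset (Fin d₁)) (S₂ : Finset (Fin d₂)),
    S₁.card = s₁ ∧ S₂.card = s₂ ∧ M ∈ ThetaOn S₁ S₂ μ}

/-- The risk of a `{0, 1}`-valued function of the data: type I error plus the supremum of the
type II error over the alternative. -/
def risk (s₁ s₂ : ℕ) {d₁ d₂ : ℕ} (Δ : Matrix (Fin d₁) (Fin d₂) ℝ → Fin 2) (μ : ℝ) : ℝ≥0∞ :=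
  obsLaw (0 : Matrix (Fin d₁) (Fin d₂) ℝ) {Y | Δ Y = 1} +
    ⨆ X ∈ Theta s₁ s₂ d₁ d₂ μ, obsLaw X {Y | Δ Y = 0}

/-! ### The rates -/

/-- `log (e * (d choose s))`. -/
def logBinom (d s : ℕ) : ℝ := Real.log (Real.exp 1 * (d.choose s : ℝ))

/-- The rate `ψ(s₁, s₂, d₁, d₂)`. -/
def psiRate (s₁ s₂ d₁ d₂ : ℕ) : ℝ :=
  1 / (s₁ : ℝ) * Real.log (1 + (d₂ : ℝ) / (s₂ : ℝ) ^ 2 * logBinom d₁ s₁)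

/-- The rate `φ(s₁, s₂, d₁, d₂)`. -/
def phiRate (s₁ s₂ d₁ d₂ : ℕ) : ℝ :=
  (d₁ : ℝ) / (s₁ : ℝ) ^ 2 * Real.log (1 + (d₂ : ℝ) / (s₂ : ℝ) ^ 2)

/-- The rate `β(s₁, s₂, d₁, d₂)`. -/
def betaRate (s₁ s₂ d₁ d₂ : ℕ) : ℝ :=
  1 / ((s₁ : ℝ) * (s₂ : ℝ)) * Real.log (d₂.choose s₂ : ℝ) *
    (if 1 < (d₁ : ℝ) / (s₁ : ℝ) ^ 2 * logBinom d₂ s₂ then 1 else 0)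

/-- The rate `(ψ₁₂ + ψ₂₁) ∧ φ₁₂ ∧ φ₂₁`. -/
def separationRate (s₁ s₂ d₁ d₂ : ℕ) : ℝ :=
  min (psiRate s₁ s₂ d₁ d₂ + psiRate s₂ s₁ d₂ d₁)
    (min (phiRate s₁ s₂ d₁ d₂) (phiRate s₂ s₁ d₂ d₁))

/-- The rate `R̃ = (ψ₁₂ + β₂₁) ∧ (ψ₂₁ + β₁₂) ∧ φ₁₂ ∧ φ₂₁`. -/
def rTilde (s₁ s₂ d₁ d₂ : ℕ) : ℝ :=
  min (psiRate s₁ s₂ d₁ d₂ + betaRate s₂ s₁ d₂ d₁)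
    (min (psiRate s₂ s₁ d₂ d₁ + betaRate s₁ s₂ d₁ d₂)
      (min (phiRate s₁ s₂ d₁ d₂) (phiRate s₂ s₁ d₂ d₁)))

/-! ### The test statistics -/

/-- `ν_τ = E[Z² | |Z| > τ]` for a standard normal `Z`. -/
def nu (τ : ℝ) : ℝ := ∫ z, z ^ 2 ∂((gaussianReal 0 1)[|{z : ℝ | τ < |z|}])

/-- The truncated and recentred square `(y² - ν_τ) 1(|y| > τ)`. -/
def truncSq (τ y : ℝ) : ℝ := (y ^ 2 - nu τ) * (if τ < |y| then 1 else 0)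

/-- The normalized sum over the rows in `J` of the column `j`. -/
def colSum {d₁ d₂ : ℕ} (Y : Matrix (Fin d₁) (Fin d₂) ℝ) (J : Finset (Fin d₁)) (j : Fin d₂) : ℝ :=
  1 / Real.sqrt (J.card : ℝ) * ∑ i ∈ J, Y i j

/-- The truncated chi-square statistic of the full column sums, with truncation level `τ`. -/
def truncChiStat {d₁ d₂ : ℕ} (τ : ℝ) (Y : Matrix (Fin d₁) (Fin d₂) ℝ) : ℝ :=
  ∑ j : Fin d₂, truncSq τ (colSum Y Finset.univ j)

/-- The Bonferroni corrected truncated chi-square statistic: maximum over all sets `J` of `s₁` rows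
(a finite, nonempty family when `s₁ ≤ d₁`). -/
def maxTruncChiStat {d₁ d₂ : ℕ} (s₁ : ℕ) (τ : ℝ) (Y : Matrix (Fin d₁) (Fin d₂) ℝ) : ℝ :=
  ⨆ J : {J : Finset (Fin d₁) // J.card = s₁}, ∑ j : Fin d₂, truncSq τ (colSum Y J.1 j)

/-- The linear statistic. -/
def linStat {d₁ d₂ : ℕ} (Y : Matrix (Fin d₁) (Fin d₂) ℝ) : ℝ :=
  1 / Real.sqrt ((d₁ : ℝ) * (d₂ : ℝ)) * ∑ i : Fin d₁, ∑ j : Fin d₂, Y i j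

/-- The Bonferroni corrected linear statistic: maximum over all sets `J` of `s₁` rows. -/
def maxLinStat {d₁ d₂ : ℕ} (s₁ : ℕ) (Y : Matrix (Fin d₁) (Fin d₂) ℝ) : ℝ :=
  ⨆ J : {J : Finset (Fin d₁) // J.card = s₁},
    1 / Real.sqrt (d₂ : ℝ) * ∑ j : Fin d₂, colSum Y J.1 j

/-! ### The tests -/

/-- The test that rejects when the statistic `t` exceeds `h`. -/
def thresholdTest {d₁ d₂ : ℕ} (t : Matrix (Fin d₁) (Fin d₂) ℝ → ℝ) (h : ℝ) :
    Matrix (Fin d₁) (Fin d₂) ℝ → Fin 2 :=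
  fun Y => if h < t Y then 1 else 0

/-- The truncated chi-square test `Δ_{trunc-χ², 1}`; `K` is the constant in the truncation level. -/
def truncChiTest (K : ℝ) (s₂ : ℕ) {d₁ d₂ : ℕ} (h : ℝ) : Matrix (Fin d₁) (Fin d₂) ℝ → Fin 2 :=
  thresholdTest (truncChiStat (Real.sqrt (K * Real.log (1 + (d₂ : ℝ) / (s₂ : ℝ) ^ 2)))) h

/-- The Bonferroni corrected truncated chi-square test `Δ_{max-trunc-χ², 1}`; `K` is the constant
in the truncation level. -/
def maxTruncChiTest (K : ℝ) (s₁ s₂ : ℕ) {d₁ d₂ : ℕ} (h : ℝ) :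
    Matrix (Fin d₁) (Fin d₂) ℝ → Fin 2 :=
  thresholdTest (maxTruncChiStat s₁
    (Real.sqrt (K * Real.log (1 + (d₂ : ℝ) / (s₂ : ℝ) ^ 2 * logBinom d₁ s₁)))) h

/-- The test `Δ_a` with cutoffs `h` (truncated chi-square test) and `h'` (linear test). For the
transposed data and `s₁` in place of `s₂` it is `Δ_b`. -/
def testA (K : ℝ) (s₂ : ℕ) {d₁ d₂ : ℕ} (h h' : ℝ) : Matrix (Fin d₁) (Fin d₂) ℝ → Fin 2 :=
  if 1 ≤ (d₂ : ℝ) / (s₂ : ℝ) ^ 2 then truncChiTest K s₂ h else thresholdTest linStat h'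

/-- The test `Δ_c` with cutoffs `h` (Bonferroni corrected truncated chi-square test) and `h'`
(Bonferroni corrected linear test). For the transposed data and `s₁`, `s₂` exchanged it is `Δ_d`. -/
def testC (K : ℝ) (s₁ s₂ : ℕ) {d₁ d₂ : ℕ} (h h' : ℝ) : Matrix (Fin d₁) (Fin d₂) ℝ → Fin 2 :=
  if 1 ≤ (d₂ : ℝ) / (s₂ : ℝ) ^ 2 * logBinom d₁ s₁ then maxTruncChiTest K s₁ s₂ h
  else thresholdTest (maxLinStat s₁) h'

/-- The test `Δ*` with cutoffs `h₁, h₁', h₂, h₂', h₃, h₃', h₄, h₄'`: the first of `Δ_a`, `Δ_b`,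
`Δ_c`, `Δ_d` whose rate attains the minimum `R̃`. -/
def optimalTest (K : ℝ) (s₁ s₂ d₁ d₂ : ℕ) (h₁ h₁' h₂ h₂' h₃ h₃' h₄ h₄' : ℝ) :
    Matrix (Fin d₁) (Fin d₂) ℝ → Fin 2 :=
  fun Y =>
    if rTilde s₁ s₂ d₁ d₂ = phiRate s₁ s₂ d₁ d₂ then testA K s₂ h₁ h₂ Y
    else if rTilde s₁ s₂ d₁ d₂ = phiRate s₂ s₁ d₂ d₁ then testA K s₁ h₁' h₂' Yᵀ
    else if rTilde s₁ s₂ d₁ d₂ = psiRate s₁ s₂ d₁ d₂ + betaRate s₂ s₁ d₂ d₁ then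
      testC K s₁ s₂ h₃ h₄ Y
    else testC K s₂ s₁ h₃' h₄' Yᵀ

end SubmatrixDetection

end

open SubmatrixDetection

/-!
# Upper bounds for the detection of a sparse submatrix

All four tests are instances of one construction, the scan over sets of `k` rows: take the maximum,
over all sets `J` of `k` rows, of a statistic of the normalized column sums over `J`. For `k = s₁`
this is the Bonferroni corrected test; for `k = d₁` there is only one set `J`, the logarithmic
factor `logBinom d₁ d₁` equals `1`, and the scan is the test based on the full column sums
(`testA_eq_testC`). The tests with index `2` reduce to those with index `1` because the noise is
invariant under transposition (`risk_comp_transpose_le`). So everything follows from one risk bound,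
`risk_testC_le`.

Write `L = logBinom d₁ k` and `ℓ = log (1 + d₂ L / s₂²)`. Under the null hypothesis the column sums
over a fixed `J` are independent standard normal variables, and the union bound over `J` costs
`exp L`. Under the alternative a single `J` containing the signal rows is enough; there the `s₂`
signal columns have means at least `θ = s₁ μ / √k`.

For the truncated chi-square statistic both errors come from the exponential Markov inequality
(`pi_le_sum_le`) and two moment bounds for `g_τ = truncSq τ` and a standard normal `Z`, valid for
`|lam| ≤ 1 / 40`.
* `E exp (lam g_τ(Z)) ≤ exp (12800 lam² exp (-τ² / 8))` (`lintegral_exp_mul_truncSq_le`): the mean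
  of `g_τ(Z)` is zero, and the second-order term lives on `|Z| > τ`. With `K = 8` the factor
  `exp (-τ² / 8)` is exactly `1 / (1 + d₂ L / s₂²)`, so all `d₂` null columns together contribute at
  most a multiple of `lam² s₂² / L`.
* `E exp (-lam g_τ(a + Z)) ≤ exp (-lam (θ² / 2 - 5 τ² - 12))` for `a ≥ θ` and `lam ≥ 0`
  (`lintegral_exp_neg_mul_truncSq_add_le`), from the pointwise bound `g_τ(y) ≥ y² - τ² - ν_τ` and
  from `ν_τ ≤ 4 τ² + 10`.

The type I error uses `lam` of order `L / (s₂ + L)` and the type II error `lam` of order `1 / s₂`;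
the test succeeds as soon as `θ²` exceeds a multiple of `ℓ + L / s₂`. When `d₂ L / s₂² < 1` the linear
statistic is a standard normal variable shifted by at least `s₂ θ / √d₂`, and a multiple of `ℓ`
suffices for `θ²`. These requirements are what the rates `φ₁₂` (for `k = d₁`) and `ψ₁₂ + β₂₁` (for
`k = s₁`) express. Finally `rTilde ≤ 3 * separationRate` (`rTilde_le_separationRate`), so the
assumption on `μ` is strong enough for whichever test is selected.
-/

namespace SubmatrixDetection

/-! ### One-dimensional Gaussian estimates -/

lemma gaussianPDFReal_mul_exp_sq (c z : ℝ) :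
    gaussianPDFReal 0 1 z * Real.exp (c * z ^ 2) =
      (Real.sqrt (2 * Real.pi))⁻¹ * Real.exp (-(1 / 2 - c) * z ^ 2) := by
  rw [gaussianPDFReal, mul_assoc, ← Real.exp_add]
  congr 2
  · simp
  · simp
    ring

lemma integrable_exp_mul_sq {c : ℝ} (hc : c < 1 / 2) :
    Integrable (fun z : ℝ => Real.exp (c * z ^ 2)) (gaussianReal 0 1) := by
  rw [gaussianReal_of_var_ne_zero _ one_ne_zero,
    integrable_withDensity_iff_integrable_smul' (measurable_gaussianPDF _ _)
      (ae_of_all _ fun _ => gaussianPDF_lt_top)]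
  simp only [toReal_gaussianPDF, smul_eq_mul, gaussianPDFReal_mul_exp_sq]
  exact (integrable_exp_neg_mul_sq (by linarith)).const_mul _

lemma integral_exp_mul_sq {c : ℝ} (hc : c < 1 / 2) :
    ∫ z, Real.exp (c * z ^ 2) ∂(gaussianReal 0 1) = (Real.sqrt (1 - 2 * c))⁻¹ := by
  rw [integral_gaussianReal_eq_integral_smul one_ne_zero]
  simp only [smul_eq_mul, gaussianPDFReal_mul_exp_sq]
  rw [integral_const_mul, integral_gaussian, ← Real.sqrt_inv, ← Real.sqrt_inv,
    ← Real.sqrt_mul (by positivity)]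
  congr 1
  have := Real.pi_pos
  have : (1 / 2 - c) ≠ 0 := by linarith
  have : (1 - 2 * c) ≠ 0 := by linarith
  field_simp

lemma integral_exp_three_eighths_sq :
    ∫ z, Real.exp (3 / 8 * z ^ 2) ∂(gaussianReal 0 1) = 2 := by
  rw [integral_exp_mul_sq (by norm_num), show (1 - 2 * (3 / 8) : ℝ) = (1 / 2) ^ 2 by norm_num,
    Real.sqrt_sq (by norm_num)]
  norm_num

lemma integral_exp_quarter_sq_le :
    ∫ z, Real.exp (1 / 4 * z ^ 2) ∂(gaussianReal 0 1) ≤ 3 / 2 := by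
  rw [integral_exp_mul_sq (by norm_num), ← Real.sqrt_inv]
  exact Real.sqrt_le_iff.2 ⟨by norm_num, by norm_num⟩

lemma integrable_sq_gaussian : Integrable (fun z : ℝ => z ^ 2) (gaussianReal 0 1) := by
  refine Integrable.mono' ((integrable_exp_mul_sq (c := 1 / 4) (by norm_num)).const_mul 4)
    (by fun_prop) (ae_of_all _ fun z => ?_)
  have := Real.add_one_le_exp (1 / 4 * z ^ 2)
  rw [Real.norm_of_nonneg (sq_nonneg z)]
  linarith

lemma measurableSet_lt_abs (τ : ℝ) : MeasurableSet {z : ℝ | τ < |z|} :=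
  measurableSet_lt measurable_const (by fun_prop)

lemma exp_le_gaussianReal_lt_abs {τ : ℝ} (hτ : 0 ≤ τ) :
    Real.exp (-τ ^ 2 - 2) ≤ (gaussianReal 0 1).real {z : ℝ | τ < |z|} := by
  have hsub : Set.Ioc τ (τ + 1) ⊆ {z : ℝ | τ < |z|} := fun z hz =>
    hz.1.trans_le (le_abs_self z)
  refine le_trans ?_ (measureReal_mono hsub)
  rw [measureReal_def, gaussianReal_apply_eq_integral _ one_ne_zero,
    ENNReal.toReal_ofReal (integral_nonneg fun _ => gaussianPDFReal_nonneg _ _ _)]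
  have hvol : ∫ _ in Set.Ioc τ (τ + 1), Real.exp (-τ ^ 2 - 2) = Real.exp (-τ ^ 2 - 2) := by
    simp
  rw [← hvol]
  refine setIntegral_mono_on (by simp) (integrable_gaussianPDFReal _ _).integrableOn
    measurableSet_Ioc fun z hz => ?_
  have hz2 : z ^ 2 ≤ 2 * τ ^ 2 + 2 := by nlinarith [hz.1, hz.2, sq_nonneg (τ - 1)]
  have hpi : Real.exp (-1) ≤ (Real.sqrt (2 * Real.pi))⁻¹ := by
    rw [Real.exp_neg]
    refine inv_anti₀ (by have := Real.pi_pos; positivity) (Real.sqrt_le_iff.2 ⟨by positivity, ?_⟩)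
    have := Real.pi_lt_d2
    have := Real.exp_one_gt_d9
    nlinarith
  calc Real.exp (-τ ^ 2 - 2) = Real.exp (-1) * Real.exp (-τ ^ 2 - 1) := by
        rw [← Real.exp_add]; ring_nf
    _ ≤ (Real.sqrt (2 * Real.pi))⁻¹ * Real.exp (-z ^ 2 / 2) := by
        gcongr
        linarith
    _ = gaussianPDFReal 0 1 z := by simp [gaussianPDFReal]

lemma gaussianReal_lt_abs_pos {τ : ℝ} (hτ : 0 ≤ τ) :
    0 < (gaussianReal 0 1).real {z : ℝ | τ < |z|} :=
  (Real.exp_pos _).trans_le (exp_le_gaussianReal_lt_abs hτ)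

lemma nu_eq (τ : ℝ) :
    nu τ = ((gaussianReal 0 1).real {z : ℝ | τ < |z|})⁻¹ *
      ∫ z in {z : ℝ | τ < |z|}, z ^ 2 ∂(gaussianReal 0 1) := by
  rw [nu, ProbabilityTheory.cond, integral_smul_measure, measureReal_def, ENNReal.toReal_inv,
    smul_eq_mul]

lemma nu_nonneg (τ : ℝ) : 0 ≤ nu τ := integral_nonneg fun _ => sq_nonneg _

/-- The truncated second moment exceeds `τ²` by at most a multiple of `1 + τ²`. Instead of the exact
Mills ratio, this uses `u ≤ exp (u - b) + b - 1` with `u = z² / 4` and `b = τ² + 2`, for which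
`exp (-b)` is at most the probability of the conditioning event. -/
lemma nu_le {τ : ℝ} (hτ : 0 ≤ τ) : nu τ ≤ 4 * τ ^ 2 + 10 := by
  set A := {z : ℝ | τ < |z|} with hA
  set p := (gaussianReal 0 1).real A with hp
  have hp0 : 0 < p := gaussianReal_lt_abs_pos hτ
  have hpe : Real.exp (-(τ ^ 2 + 2)) ≤ p :=
    le_of_eq_of_le (by ring_nf) (exp_le_gaussianReal_lt_abs hτ)
  have hint := integrable_exp_mul_sq (c := 1 / 4) (by norm_num)
  have h1 : ∫ z in A, z ^ 2 ∂(gaussianReal 0 1) ≤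
      ∫ z in A, (4 * Real.exp (-(τ ^ 2 + 2)) * Real.exp (1 / 4 * z ^ 2) + 4 * (τ ^ 2 + 1))
        ∂(gaussianReal 0 1) := by
    refine integral_mono integrable_sq_gaussian.integrableOn
      ((hint.const_mul _).add (integrable_const _)).integrableOn fun z => ?_
    have := Real.add_one_le_exp (-(τ ^ 2 + 2) + 1 / 4 * z ^ 2)
    rw [Real.exp_add] at this
    simp only
    linarith
  rw [integral_add (hint.const_mul _).integrableOn (integrable_const _), integral_const_mul,
    setIntegral_const, smul_eq_mul] at h1
  have h2 : ∫ z in A, Real.exp (1 / 4 * z ^ 2) ∂(gaussianReal 0 1) ≤ 3 / 2 :=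
    (setIntegral_le_integral hint (ae_of_all _ fun _ => (Real.exp_pos _).le)).trans
      integral_exp_quarter_sq_le
  have h3 : 4 * Real.exp (-(τ ^ 2 + 2)) * ∫ z in A, Real.exp (1 / 4 * z ^ 2) ∂(gaussianReal 0 1)
      ≤ 4 * p * (3 / 2) := by
    refine mul_le_mul (by linarith) h2 (integral_nonneg fun _ => (Real.exp_pos _).le)
      (by positivity)
  rw [nu_eq, inv_mul_le_iff₀ hp0]
  calc _ ≤ 4 * p * (3 / 2) + p * (4 * (τ ^ 2 + 1)) := by linarith
    _ = _ := by ring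

@[fun_prop]
lemma measurable_truncSq (τ : ℝ) : Measurable (truncSq τ) := by
  unfold truncSq
  refine ((measurable_id.pow_const 2).sub measurable_const).mul ?_
  exact Measurable.ite (measurableSet_lt_abs τ) measurable_const measurable_const

lemma truncSq_eq_indicator (τ : ℝ) :
    truncSq τ = Set.indicator {z : ℝ | τ < |z|} (fun z => z ^ 2 - nu τ) := by
  ext z
  by_cases h : τ < |z| <;> simp [truncSq, Set.indicator, h]

lemma integrable_truncSq (τ : ℝ) : Integrable (truncSq τ) (gaussianReal 0 1) := by
  rw [truncSq_eq_indicator]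
  exact (integrable_sq_gaussian.sub (integrable_const _)).indicator (measurableSet_lt_abs τ)

lemma integral_truncSq {τ : ℝ} (hτ : 0 ≤ τ) : ∫ z, truncSq τ z ∂(gaussianReal 0 1) = 0 := by
  rw [truncSq_eq_indicator, integral_indicator (measurableSet_lt_abs τ),
    integral_sub integrable_sq_gaussian.integrableOn (integrable_const _), setIntegral_const, nu_eq,
    smul_eq_mul, mul_inv_cancel_left₀ (gaussianReal_lt_abs_pos hτ).ne', sub_self]

lemma exp_le_one_add_add_sq_mul_exp_abs (x : ℝ) :
    Real.exp x ≤ 1 + x + x ^ 2 * Real.exp |x| := by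
  have hone : 1 ≤ Real.exp |x| := Real.one_le_exp (abs_nonneg x)
  rcases le_or_gt |x| 1 with h | h
  · have := (abs_le.1 (Real.abs_exp_sub_one_sub_id_le h)).2
    nlinarith [sq_nonneg x]
  · rcases le_or_gt 0 x with h0 | h0
    · rw [abs_of_nonneg h0] at *
      have : 1 * Real.exp x ≤ x ^ 2 * Real.exp x := by gcongr; nlinarith
      linarith
    · rw [abs_of_neg h0] at *
      have : Real.exp x ≤ 1 := Real.exp_le_one_iff.2 h0.le
      nlinarith [sq_nonneg x]

/-- Second-order bound with the decay `exp (-τ² / 8)`: the statistic vanishes for `|z| ≤ τ`, and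
for `|z| > τ` a fraction `z² / 8` of the exponent is traded for `τ² / 8`. -/
lemma exp_mul_truncSq_le {τ lam : ℝ} (hτ : 0 ≤ τ) (hlam : |lam| ≤ 1 / 40) (z : ℝ) :
    Real.exp (lam * truncSq τ z) ≤ 1 + lam * truncSq τ z +
      6400 * lam ^ 2 * Real.exp (-τ ^ 2 / 8) * Real.exp (3 / 8 * z ^ 2) := by
  by_cases hz : τ < |z|
  swap
  · simp only [truncSq, hz, if_false, mul_zero, Real.exp_zero, add_zero]
    have : 0 ≤ 6400 * lam ^ 2 * Real.exp (-τ ^ 2 / 8) * Real.exp (3 / 8 * z ^ 2) := by positivity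
    linarith
  have hτz : τ ^ 2 ≤ z ^ 2 := by
    rw [← sq_abs z]; exact pow_le_pow_left₀ hτ hz.le 2
  set g := truncSq τ z with hg
  have hgz : |g| ≤ 5 * z ^ 2 + 10 := by
    rw [hg, truncSq, if_pos hz, mul_one, abs_le]
    constructor <;> nlinarith [nu_le hτ, nu_nonneg τ]
  set u := |g| / 40 with hu
  have hu0 : 0 ≤ u := by positivity
  have hlu : |lam * g| ≤ u := by
    rw [abs_mul, hu]
    nlinarith [abs_nonneg g]
  refine (exp_le_one_add_add_sq_mul_exp_abs _).trans (add_le_add le_rfl ?_)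
  have hquad : u ^ 2 ≤ 2 * Real.exp u := by
    have := Real.quadratic_le_exp_of_nonneg hu0
    linarith
  have hg2 : g ^ 2 = 1600 * u ^ 2 := by rw [hu, div_pow, sq_abs]; ring
  have hhalf : Real.exp (1 / 2) ≤ 2 := by
    have : Real.exp (1 / 2) ^ 2 = Real.exp 1 := by rw [← Real.exp_nat_mul]; norm_num
    nlinarith [Real.exp_one_lt_d9, Real.exp_pos (1 / 2)]
  calc (lam * g) ^ 2 * Real.exp |lam * g|
      ≤ (lam * g) ^ 2 * Real.exp u := by gcongr
    _ = 1600 * lam ^ 2 * (u ^ 2 * Real.exp u) := by rw [mul_pow, hg2]; ring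
    _ ≤ 1600 * lam ^ 2 * (2 * Real.exp u * Real.exp u) := by gcongr
    _ = 3200 * lam ^ 2 * Real.exp (2 * u) := by rw [two_mul u, Real.exp_add]; ring
    _ ≤ 3200 * lam ^ 2 * Real.exp (1 / 2 + (-τ ^ 2 / 8 + 3 / 8 * z ^ 2)) := by
        gcongr
        rw [hu]
        linarith
    _ = 3200 * lam ^ 2 *
        (Real.exp (1 / 2) * (Real.exp (-τ ^ 2 / 8) * Real.exp (3 / 8 * z ^ 2))) := by
        rw [Real.exp_add, Real.exp_add]
    _ ≤ 3200 * lam ^ 2 * (2 * (Real.exp (-τ ^ 2 / 8) * Real.exp (3 / 8 * z ^ 2))) := by gcongr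
    _ = _ := by ring

lemma lintegral_exp_mul_truncSq_le {τ lam : ℝ} (hτ : 0 ≤ τ) (hlam : |lam| ≤ 1 / 40) :
    ∫⁻ z, ENNReal.ofReal (Real.exp (lam * truncSq τ z)) ∂(gaussianReal 0 1) ≤
      ENNReal.ofReal (Real.exp (12800 * lam ^ 2 * Real.exp (-τ ^ 2 / 8))) := by
  have hint := (integrable_exp_mul_sq (c := 3 / 8) (by norm_num)).const_mul
    (6400 * lam ^ 2 * Real.exp (-τ ^ 2 / 8))
  have hint1 : Integrable (fun z => 1 + lam * truncSq τ z) (gaussianReal 0 1) :=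
    (integrable_const _).add ((integrable_truncSq τ).const_mul lam)
  have hsum : Integrable (fun z => 1 + lam * truncSq τ z + 6400 * lam ^ 2 *
      Real.exp (-τ ^ 2 / 8) * Real.exp (3 / 8 * z ^ 2)) (gaussianReal 0 1) := hint1.add hint
  refine (lintegral_mono fun z => ENNReal.ofReal_le_ofReal (exp_mul_truncSq_le hτ hlam z)).trans ?_
  rw [← ofReal_integral_eq_lintegral_ofReal hsum
    (ae_of_all _ fun z => (Real.exp_pos _).le.trans (exp_mul_truncSq_le hτ hlam z))]
  refine ENNReal.ofReal_le_ofReal ?_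
  have : ∫ z, (1 + lam * truncSq τ z + 6400 * lam ^ 2 * Real.exp (-τ ^ 2 / 8) *
      Real.exp (3 / 8 * z ^ 2)) ∂(gaussianReal 0 1) =
      1 + 12800 * lam ^ 2 * Real.exp (-τ ^ 2 / 8) := by
    rw [integral_add hint1 hint, integral_add (integrable_const _)
      ((integrable_truncSq τ).const_mul lam), integral_const_mul, integral_const_mul,
      integral_truncSq hτ, integral_exp_three_eighths_sq]
    simp
    ring
  refine le_of_eq_of_le this ?_
  linarith [Real.add_one_le_exp (12800 * lam ^ 2 * Real.exp (-τ ^ 2 / 8))]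

lemma sub_le_truncSq (τ y : ℝ) : y ^ 2 - τ ^ 2 - nu τ ≤ truncSq τ y := by
  by_cases h : τ < |y|
  · rw [truncSq, if_pos h]
    nlinarith [sq_nonneg τ]
  · rw [truncSq, if_neg h]
    have : y ^ 2 ≤ τ ^ 2 := by
      rw [← sq_abs y]; exact pow_le_pow_left₀ (abs_nonneg y) (not_lt.1 h) 2
    nlinarith [nu_nonneg τ]

/-- Behaviour on a signal column: pointwise the statistic is at least `θ² / 2 - z² - 5 τ² - 10`,
whatever the size of the shift `a ≥ θ`. -/
lemma lintegral_exp_neg_mul_truncSq_add_le {τ lam θ a : ℝ} (hτ : 0 ≤ τ) (hlam : 0 ≤ lam)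
    (hlam' : lam ≤ 1 / 40) (hθ : 0 ≤ θ) (ha : θ ≤ a) :
    ∫⁻ z, ENNReal.ofReal (Real.exp (-lam * truncSq τ (a + z))) ∂(gaussianReal 0 1) ≤
      ENNReal.ofReal (Real.exp (-lam * (θ ^ 2 / 2 - 5 * τ ^ 2 - 12))) := by
  have hpt : ∀ z : ℝ, Real.exp (-lam * truncSq τ (a + z)) ≤
      Real.exp (-lam * (θ ^ 2 / 2 - 5 * τ ^ 2 - 10)) *
        (1 - 4 * lam + 4 * lam * Real.exp (1 / 4 * z ^ 2)) := by
    intro z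
    have h1 : θ ^ 2 / 2 - 5 * τ ^ 2 - 10 - z ^ 2 ≤ truncSq τ (a + z) := by
      have := sub_le_truncSq τ (a + z)
      have := nu_le hτ
      nlinarith [sq_nonneg (a / 2 + z), sq_nonneg (a + 2 * z)]
    -- convexity of `exp` between `0` and `z² / 4`
    have h2 : Real.exp (lam * z ^ 2) ≤ 1 - 4 * lam + 4 * lam * Real.exp (1 / 4 * z ^ 2) := by
      have := convexOn_exp.2 (Set.mem_univ 0) (Set.mem_univ (1 / 4 * z ^ 2))
        (show 0 ≤ 1 - 4 * lam by linarith) (show 0 ≤ 4 * lam by linarith) (by ring)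
      simp only [smul_eq_mul, mul_zero, zero_add, Real.exp_zero, mul_one] at this
      rwa [show 4 * lam * (1 / 4 * z ^ 2) = lam * z ^ 2 by ring] at this
    calc Real.exp (-lam * truncSq τ (a + z))
        ≤ Real.exp (-lam * (θ ^ 2 / 2 - 5 * τ ^ 2 - 10) + lam * z ^ 2) := by
          gcongr
          nlinarith
      _ = Real.exp (-lam * (θ ^ 2 / 2 - 5 * τ ^ 2 - 10)) * Real.exp (lam * z ^ 2) :=
          Real.exp_add _ _
      _ ≤ _ := by gcongr
  have hint := (integrable_exp_mul_sq (c := 1 / 4) (by norm_num)).const_mul (4 * lam)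
  have hsum : Integrable (fun z => Real.exp (-lam * (θ ^ 2 / 2 - 5 * τ ^ 2 - 10)) *
      (1 - 4 * lam + 4 * lam * Real.exp (1 / 4 * z ^ 2))) (gaussianReal 0 1) :=
    ((integrable_const _).add hint).const_mul _
  refine (lintegral_mono fun z => ENNReal.ofReal_le_ofReal (hpt z)).trans ?_
  rw [← ofReal_integral_eq_lintegral_ofReal hsum
    (ae_of_all _ fun z => (Real.exp_pos _).le.trans (hpt z))]
  refine ENNReal.ofReal_le_ofReal ?_
  rw [integral_const_mul, integral_add (integrable_const _) hint, integral_const_mul]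
  have h3 : (∫ _ : ℝ, (1 - 4 * lam) ∂(gaussianReal 0 1)) +
      4 * lam * ∫ z, Real.exp (1 / 4 * z ^ 2) ∂(gaussianReal 0 1) ≤ Real.exp (2 * lam) := by
    have h4 := mul_le_mul_of_nonneg_left integral_exp_quarter_sq_le
      (show 0 ≤ 4 * lam by linarith)
    have := Real.add_one_le_exp (2 * lam)
    rw [integral_const, probReal_univ, smul_eq_mul]
    linarith
  calc _ ≤ Real.exp (-lam * (θ ^ 2 / 2 - 5 * τ ^ 2 - 10)) * Real.exp (2 * lam) := by gcongr
    _ = _ := by rw [← Real.exp_add]; ring_nf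

/-- Gaussian tail bound. -/
lemma gaussianReal_le_exp {h : ℝ} (hh : 0 ≤ h) :
    gaussianReal 0 1 (Set.Ici h) ≤ ENNReal.ofReal (Real.exp (-h ^ 2 / 2)) := by
  have hint : Integrable (fun z : ℝ => Real.exp (h * z)) (gaussianReal 0 1) :=
    integrable_exp_mul_gaussianReal h
  have := measure_ge_le_exp_mul_mgf (μ := gaussianReal 0 1) (X := id) h hh hint
  rw [mgf_id_gaussianReal, ← Real.exp_add] at this
  rw [← ofReal_measureReal]
  refine ENNReal.ofReal_le_ofReal (this.trans_eq ?_)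
  simp
  ring

/-! ### Laws of the column sums and the exponential Markov inequality -/

lemma map_curry_infinitePi_gaussianReal (d₁ d₂ : ℕ) :
    (Measure.infinitePi fun _ : Fin d₁ × Fin d₂ => gaussianReal 0 1).map
      (MeasurableEquiv.curry (Fin d₁) (Fin d₂) ℝ) =
      Measure.pi fun _ : Fin d₁ => Measure.pi fun _ : Fin d₂ => gaussianReal 0 1 := by
  have h := Measure.infinitePi_map_curry fun (_ : Fin d₁) (_ : Fin d₂) => gaussianReal 0 1
  rw [h, Measure.infinitePi_eq_pi]
  simp_rw [Measure.infinitePi_eq_pi]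

lemma map_swap_pi_pi_gaussianReal (d₁ d₂ : ℕ) :
    (Measure.pi fun _ : Fin d₁ => Measure.pi fun _ : Fin d₂ => gaussianReal 0 1).map
      (fun E j i => E i j) =
      Measure.pi fun _ : Fin d₂ => Measure.pi fun _ : Fin d₁ => gaussianReal 0 1 := by
  have hswap := Measure.infinitePi_map_piCongrLeft
    (fun _ : Fin d₂ × Fin d₁ => gaussianReal 0 1) (Equiv.prodComm (Fin d₁) (Fin d₂))
  rw [← map_curry_infinitePi_gaussianReal d₂ d₁, ← hswap, ← map_curry_infinitePi_gaussianReal,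
    Measure.map_map (by fun_prop) (MeasurableEquiv.measurable _),
    Measure.map_map (MeasurableEquiv.measurable _) (MeasurableEquiv.measurable _)]
  rfl

lemma measurable_transpose (d₁ d₂ : ℕ) :
    Measurable (Matrix.transpose : Matrix (Fin d₁) (Fin d₂) ℝ → Matrix (Fin d₂) (Fin d₁) ℝ) :=
  measurable_pi_lambda _ fun j => measurable_pi_lambda _ fun i =>
    (measurable_pi_apply (X := fun _ => ℝ) j).comp
      (measurable_pi_apply (X := fun _ => Fin d₂ → ℝ) i)

lemma measurable_entry {d₁ d₂ : ℕ} (i : Fin d₁) (j : Fin d₂) :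
    Measurable fun Y : Matrix (Fin d₁) (Fin d₂) ℝ => Y i j :=
  (measurable_pi_apply (X := fun _ => ℝ) j).comp
    (measurable_pi_apply (X := fun _ => Fin d₂ → ℝ) i)

lemma measurable_const_add_matrix {d₁ d₂ : ℕ} (X : Matrix (Fin d₁) (Fin d₂) ℝ) :
    Measurable fun E : Matrix (Fin d₁) (Fin d₂) ℝ => X + E :=
  measurable_pi_lambda _ fun i => measurable_pi_lambda _ fun j =>
    (measurable_entry i j).const_add (X i j)

/-- Transposing the noise exchanges the roles of the rows and the columns. -/
lemma map_transpose_noiseLaw (d₁ d₂ : ℕ) :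
    (noiseLaw d₁ d₂).map Matrix.transpose = noiseLaw d₂ d₁ :=
  map_swap_pi_pi_gaussianReal d₁ d₂

lemma map_sum_mul_pi_gaussianReal {ι : Type*} [Fintype ι] (c : ι → ℝ) (hc : ∑ i, c i ^ 2 = 1) :
    (Measure.pi fun _ : ι => gaussianReal 0 1).map (fun z => ∑ i, c i * z i) =
      gaussianReal 0 1 := by
  have hind : iIndepFun (fun i (z : ι → ℝ) => c i * z i)
      (Measure.pi fun _ : ι => gaussianReal 0 1) :=
    iIndepFun_pi (X := fun i (x : ℝ) => c i * x) fun i => by fun_prop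
  have : IsProbabilityMeasure ((Measure.pi fun _ : ι => gaussianReal 0 1).map
      (fun z => ∑ i, c i * z i)) :=
    Measure.isProbabilityMeasure_map (Measurable.aemeasurable (by fun_prop))
  refine Measure.ext_of_charFun ?_
  rw [hind.charFun_map_fun_sum_eq_prod fun i => Measurable.aemeasurable (by fun_prop)]
  ext t
  rw [Finset.prod_apply]
  have hmap : ∀ i, charFun ((Measure.pi fun _ : ι => gaussianReal 0 1).map
      fun z => c i * z i) t = Complex.exp ((c i ^ 2 : ℝ) * (-(t ^ 2 / 2))) := by
    intro i
    have h1 : (Measure.pi fun _ : ι => gaussianReal 0 1).map (fun z => z i) = gaussianReal 0 1 :=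
      (measurePreserving_eval (fun _ : ι => gaussianReal 0 1) i).map_eq
    rw [charFun_map_mul_comp (Measurable.aemeasurable (by fun_prop)), h1, charFun_gaussianReal]
    congr 1
    push_cast
    ring
  simp_rw [hmap]
  rw [← Complex.exp_sum, ← Finset.sum_mul, ← Complex.ofReal_sum, hc, charFun_gaussianReal]
  congr 1
  push_cast
  ring

lemma map_normalized_sum_pi_gaussianReal {ι : Type*} [Fintype ι] (J : Finset ι)
    (hJ : J.Nonempty) :
    (Measure.pi fun _ : ι => gaussianReal 0 1).map
      (fun z => 1 / Real.sqrt (J.card : ℝ) * ∑ i ∈ J, z i) = gaussianReal 0 1 := by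
  classical
  have hJ0 : (0 : ℝ) < J.card := by exact_mod_cast hJ.card_pos
  refine Eq.trans ?_
    (map_sum_mul_pi_gaussianReal (fun i => if i ∈ J then 1 / Real.sqrt (J.card : ℝ) else 0) ?_)
  · congr 1
    ext z
    simp [Finset.mul_sum, Finset.sum_ite_mem, ite_mul]
  · simp only [ite_pow, div_pow, one_pow, Real.sq_sqrt hJ0.le, ne_eq, OfNat.ofNat_ne_zero,
      not_false_eq_true, zero_pow, Finset.sum_ite_mem, Finset.univ_inter, Finset.sum_const,
      nsmul_eq_mul]
    field_simp

lemma measurable_colSum {d₁ d₂ : ℕ} (J : Finset (Fin d₁)) (j : Fin d₂) :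
    Measurable fun Y : Matrix (Fin d₁) (Fin d₂) ℝ => colSum Y J j := by
  unfold colSum
  exact (Finset.measurable_sum _ fun i _ => measurable_entry i j).const_mul _

/-- The normalized column sums of the noise are independent standard normal variables. -/
lemma map_colSum_noiseLaw {d₁ d₂ : ℕ} (J : Finset (Fin d₁)) (hJ : J.Nonempty) :
    (noiseLaw d₁ d₂).map (fun E j => colSum E J j) =
      Measure.pi fun _ : Fin d₂ => gaussianReal 0 1 := by
  have hm : Measurable fun z : Fin d₁ → ℝ => 1 / Real.sqrt (J.card : ℝ) * ∑ i ∈ J, z i := by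
    fun_prop
  have hm' : Measurable fun (E : Matrix (Fin d₁) (Fin d₂) ℝ) j => colSum E J j :=
    measurable_pi_lambda _ fun j => measurable_colSum J j
  have hpi : (noiseLaw d₂ d₁).map
      (fun E j => 1 / Real.sqrt (J.card : ℝ) * ∑ i ∈ J, E j i) =
      Measure.pi fun _ : Fin d₂ => gaussianReal 0 1 := by
    have := Measure.pi_map_pi (μ := fun _ : Fin d₂ => Measure.pi fun _ : Fin d₁ => gaussianReal 0 1)
      (f := fun _ z => 1 / Real.sqrt (J.card : ℝ) * ∑ i ∈ J, z i) fun _ => hm.aemeasurable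
    simp only [map_normalized_sum_pi_gaussianReal J hJ] at this
    exact this
  rw [← map_transpose_noiseLaw d₂ d₁, Measure.map_map hm' (measurable_transpose d₂ d₁)]
  exact hpi

/-- Exponential Markov inequality for a sum of functions of independent variables. -/
lemma pi_le_sum_le {ι : Type*} [Fintype ι] (P : Measure ℝ) [IsProbabilityMeasure P]
    {f : ι → ℝ → ℝ} (hf : ∀ i, Measurable (f i)) {a : ι → ℝ}
    (ha : ∀ i, ∫⁻ z, ENNReal.ofReal (Real.exp (f i z)) ∂P ≤ ENNReal.ofReal (Real.exp (a i)))
    (t : ℝ) :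
    (Measure.pi fun _ : ι => P) {z | t ≤ ∑ i, f i (z i)} ≤
      ENNReal.ofReal (Real.exp (∑ i, a i - t)) := by
  have hind : iIndepFun (fun i (z : ι → ℝ) => ENNReal.ofReal (Real.exp (f i (z i))))
      (Measure.pi fun _ : ι => P) :=
    iIndepFun_pi (X := fun i x => ENNReal.ofReal (Real.exp (f i x))) fun i => by
      have := hf i
      fun_prop
  have hprod := lintegral_prod_eq_prod_lintegral_of_indepFun Finset.univ _ hind fun i => by
    have := hf i
    fun_prop
  have hone : ∀ i, ∫⁻ z : ι → ℝ, ENNReal.ofReal (Real.exp (f i (z i))) ∂(Measure.pi fun _ : ι => P)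
      = ∫⁻ x, ENNReal.ofReal (Real.exp (f i x)) ∂P := fun i =>
    (measurePreserving_eval (fun _ : ι => P) i).lintegral_comp
      (f := fun x => ENNReal.ofReal (Real.exp (f i x))) (by have := hf i; fun_prop)
  have hexp : ∀ z : ι → ℝ, ∏ i, ENNReal.ofReal (Real.exp (f i (z i))) =
      ENNReal.ofReal (Real.exp (∑ i, f i (z i))) := fun z => by
    rw [Real.exp_sum, ENNReal.ofReal_prod_of_nonneg fun i _ => (Real.exp_pos _).le]
  simp only [hexp, hone] at hprod
  have hle : ∫⁻ z : ι → ℝ, ENNReal.ofReal (Real.exp (∑ i, f i (z i))) ∂(Measure.pi fun _ : ι => P)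
      ≤ ENNReal.ofReal (Real.exp (∑ i, a i)) := by
    rw [hprod, Real.exp_sum, ENNReal.ofReal_prod_of_nonneg fun i _ => (Real.exp_pos _).le]
    exact Finset.prod_le_prod' fun i _ => ha i
  have hmarkov := meas_ge_le_lintegral_div (μ := Measure.pi fun _ : ι => P)
    (f := fun z => ENNReal.ofReal (Real.exp (∑ i, f i (z i))))
    (Measurable.aemeasurable (by have := hf; fun_prop)) (ε := ENNReal.ofReal (Real.exp t))
    (by simpa using Real.exp_pos t) ENNReal.ofReal_ne_top
  calc (Measure.pi fun _ : ι => P) {z | t ≤ ∑ i, f i (z i)}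
      ≤ (Measure.pi fun _ : ι => P)
        {z | ENNReal.ofReal (Real.exp t) ≤ ENNReal.ofReal (Real.exp (∑ i, f i (z i)))} :=
        measure_mono fun z hz => ENNReal.ofReal_le_ofReal (Real.exp_le_exp.2 hz)
    _ ≤ _ := hmarkov
    _ ≤ ENNReal.ofReal (Real.exp (∑ i, a i)) / ENNReal.ofReal (Real.exp t) := by gcongr
    _ = _ := by rw [← ENNReal.ofReal_div_of_pos (Real.exp_pos t), ← Real.exp_sub]

/-! ### Scan tests over sets of rows -/

lemma one_le_logBinom {d s : ℕ} (h : s ≤ d) : 1 ≤ logBinom d s := by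
  have : (1 : ℝ) ≤ d.choose s := by exact_mod_cast Nat.choose_pos h
  rw [logBinom, Real.log_mul (Real.exp_pos 1).ne' (by positivity), Real.log_exp]
  linarith [Real.log_nonneg this]

lemma log_choose_eq {d s : ℕ} (h : s ≤ d) : Real.log (d.choose s) = logBinom d s - 1 := by
  have : (1 : ℝ) ≤ d.choose s := by exact_mod_cast Nat.choose_pos h
  rw [logBinom, Real.log_mul (Real.exp_pos 1).ne' (by positivity), Real.log_exp]
  ring

lemma choose_le_exp_logBinom {d s : ℕ} (h : s ≤ d) :
    (d.choose s : ℝ) ≤ Real.exp (logBinom d s) := by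
  have h1 : (0 : ℝ) < d.choose s := by exact_mod_cast Nat.choose_pos h
  rw [logBinom, Real.exp_log (by positivity)]
  nlinarith [Real.add_one_le_exp (1 : ℝ)]

/-- The maximum over all sets `J` of `k` rows of a function `F` of the normalized column sums
over `J`. -/
noncomputable def scanStat {d₁ d₂ : ℕ} (k : ℕ) (F : (Fin d₂ → ℝ) → ℝ)
    (Y : Matrix (Fin d₁) (Fin d₂) ℝ) : ℝ :=
  ⨆ J : {J : Finset (Fin d₁) // J.card = k}, F fun j => colSum Y J.1 j

lemma measurable_scanStat {d₁ d₂ : ℕ} (k : ℕ) {F : (Fin d₂ → ℝ) → ℝ} (hF : Measurable F) :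
    Measurable (scanStat (d₁ := d₁) k F) :=
  Measurable.iSup fun J => hF.comp (measurable_pi_lambda _ fun j => measurable_colSum J.1 j)

lemma measurable_thresholdTest {d₁ d₂ : ℕ} {t : Matrix (Fin d₁) (Fin d₂) ℝ → ℝ}
    (ht : Measurable t) (h : ℝ) : Measurable (thresholdTest t h) :=
  Measurable.ite (measurableSet_lt measurable_const ht) measurable_const measurable_const

lemma obsLaw_colSum_mem {d₁ d₂ : ℕ} (X : Matrix (Fin d₁) (Fin d₂) ℝ) {J : Finset (Fin d₁)}
    (hJ : J.Nonempty) {S : Set (Fin d₂ → ℝ)} (hS : MeasurableSet S) :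
    obsLaw X {Y | (fun j => colSum Y J j) ∈ S} =
      (Measure.pi fun _ : Fin d₂ => gaussianReal 0 1)
        {z | (fun j => colSum X J j + z j) ∈ S} := by
  have hcol : Measurable fun (Y : Matrix (Fin d₁) (Fin d₂) ℝ) j => colSum Y J j :=
    measurable_pi_lambda _ fun j => measurable_colSum J j
  have hshift : Measurable fun (z : Fin d₂ → ℝ) j => colSum X J j + z j := by fun_prop
  change obsLaw X ((fun Y j => colSum Y J j) ⁻¹' S) =
    (Measure.pi fun _ : Fin d₂ => gaussianReal 0 1) ((fun z j => colSum X J j + z j) ⁻¹' S)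
  rw [obsLaw, Measure.map_apply (measurable_const_add_matrix X) (hcol hS),
    ← map_colSum_noiseLaw J hJ,
    Measure.map_apply hcol (hshift hS)]
  congr 1
  ext E
  simp only [Set.mem_preimage, colSum, Matrix.add_apply, Finset.sum_add_distrib,
    mul_add]

lemma colSum_zero {d₁ d₂ : ℕ} (J : Finset (Fin d₁)) (j : Fin d₂) :
    colSum (0 : Matrix (Fin d₁) (Fin d₂) ℝ) J j = 0 := by
  simp [colSum]

lemma colSum_eq_zero_of_mem_ThetaOn {d₁ d₂ : ℕ} {S₁ : Finset (Fin d₁)} {S₂ : Finset (Fin d₂)}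
    {μ : ℝ} {X : Matrix (Fin d₁) (Fin d₂) ℝ} (hX : X ∈ ThetaOn S₁ S₂ μ) (J : Finset (Fin d₁))
    {j : Fin d₂} (hj : j ∉ S₂) : colSum X J j = 0 := by
  rw [colSum, Finset.sum_eq_zero fun i _ => hX.2 i j fun h => hj h.2, mul_zero]

lemma le_colSum_of_mem_ThetaOn {d₁ d₂ : ℕ} {S₁ : Finset (Fin d₁)} {S₂ : Finset (Fin d₂)}
    {μ : ℝ} {X : Matrix (Fin d₁) (Fin d₂) ℝ} (hX : X ∈ ThetaOn S₁ S₂ μ)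
    {J : Finset (Fin d₁)} (hJ : S₁ ⊆ J) {j : Fin d₂} (hj : j ∈ S₂) :
    (S₁.card : ℝ) * μ / Real.sqrt (J.card : ℝ) ≤ colSum X J j := by
  have hsum : (S₁.card : ℝ) * μ ≤ ∑ i ∈ J, X i j := by
    calc (S₁.card : ℝ) * μ = ∑ i ∈ S₁, μ := by simp
      _ ≤ ∑ i ∈ S₁, X i j := Finset.sum_le_sum fun i hi => hX.1 i j ⟨hi, hj⟩
      _ ≤ ∑ i ∈ J, X i j := Finset.sum_le_sum_of_subset_of_nonneg hJ fun i _ hi =>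
          (hX.2 i j fun h => hi h.1).ge
  rw [colSum, one_div_mul_eq_div]
  gcongr

/-- Risk of a scan test. The type I error is controlled by a union bound over the
`d₁.choose k ≤ exp (logBinom d₁ k)` sets of rows; for the type II error a single set `J` containing
the signal rows suffices, and there the signal columns have mean at least `s₁ * μ / √k`. -/
lemma risk_scanStat_le {s₁ s₂ k d₁ d₂ : ℕ} {μ h B : ℝ} {F : (Fin d₂ → ℝ) → ℝ}
    (hs₁ : 1 ≤ s₁) (hs₁k : s₁ ≤ k) (hkd : k ≤ d₁) (hF : Measurable F)
    (hnull : (Measure.pi fun _ : Fin d₂ => gaussianReal 0 1) {z | h < F z} ≤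
      ENNReal.ofReal (Real.exp (-(logBinom d₁ k + B))))
    (halt : ∀ S₂ : Finset (Fin d₂), S₂.card = s₂ → ∀ a : Fin d₂ → ℝ,
      (∀ j ∈ S₂, (s₁ : ℝ) * μ / Real.sqrt k ≤ a j) → (∀ j ∉ S₂, a j = 0) →
      (Measure.pi fun _ : Fin d₂ => gaussianReal 0 1) {z | F (fun j => a j + z j) ≤ h} ≤
        ENNReal.ofReal (Real.exp (-B))) :
    risk s₁ s₂ (thresholdTest (scanStat (d₁ := d₁) k F) h) μ ≤
      ENNReal.ofReal (2 * Real.exp (-B)) := by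
  have hne : Nonempty {J : Finset (Fin d₁) // J.card = k} := by
    obtain ⟨J, -, hJ⟩ := Finset.exists_subset_card_eq (s := (Finset.univ : Finset (Fin d₁)))
      (n := k) (by simpa using hkd)
    exact ⟨⟨J, hJ⟩⟩
  have hJne : ∀ J : {J : Finset (Fin d₁) // J.card = k}, J.1.Nonempty := fun J =>
    Finset.card_pos.1 (by have := J.2; omega)
  have hone : ∀ Y, thresholdTest (scanStat (d₁ := d₁) k F) h Y = 1 ↔ h < scanStat k F Y := by
    intro Y
    by_cases hY : h < scanStat k F Y <;> simp [thresholdTest, hY]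
  have hzero : ∀ Y, thresholdTest (scanStat (d₁ := d₁) k F) h Y = 0 ↔ scanStat k F Y ≤ h := by
    intro Y
    by_cases hY : h < scanStat k F Y
    · simp [thresholdTest, hY]
    · simp [thresholdTest, hY, not_lt.1 hY]
  have htype1 : obsLaw (0 : Matrix (Fin d₁) (Fin d₂) ℝ)
      {Y | thresholdTest (scanStat (d₁ := d₁) k F) h Y = 1} ≤
      ENNReal.ofReal (Real.exp (-B)) := by
    calc _ ≤ obsLaw (0 : Matrix (Fin d₁) (Fin d₂) ℝ)
          (⋃ J : {J : Finset (Fin d₁) // J.card = k}, {Y | h < F fun j => colSum Y J.1 j}) := by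
          refine measure_mono fun Y hY => ?_
          obtain ⟨J, hJ⟩ := exists_lt_of_lt_ciSup ((hone Y).1 hY)
          exact Set.mem_iUnion.2 ⟨J, hJ⟩
      _ ≤ ∑ J : {J : Finset (Fin d₁) // J.card = k}, obsLaw (0 : Matrix (Fin d₁) (Fin d₂) ℝ)
          {Y | h < F fun j => colSum Y J.1 j} := measure_iUnion_fintype_le _ _
      _ ≤ ∑ J : {J : Finset (Fin d₁) // J.card = k},
          ENNReal.ofReal (Real.exp (-(logBinom d₁ k + B))) := by
          refine Finset.sum_le_sum fun J _ => ?_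
          have := obsLaw_colSum_mem (0 : Matrix (Fin d₁) (Fin d₂) ℝ) (hJne J)
            (measurableSet_lt measurable_const hF : MeasurableSet {z | h < F z})
          simp only [colSum_zero, zero_add, Set.mem_ofPred_eq] at this
          rw [this]
          exact hnull
      _ = ENNReal.ofReal (d₁.choose k * Real.exp (-(logBinom d₁ k + B))) := by
          rw [Finset.sum_const, Finset.card_univ, Fintype.card_finset_len, Fintype.card_fin,
            nsmul_eq_mul, ENNReal.ofReal_mul (by positivity), ENNReal.ofReal_natCast]
      _ ≤ ENNReal.ofReal (Real.exp (-B)) := by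
          refine ENNReal.ofReal_le_ofReal ?_
          calc _ ≤ Real.exp (logBinom d₁ k) * Real.exp (-(logBinom d₁ k + B)) := by
                gcongr
                exact choose_le_exp_logBinom hkd
            _ = Real.exp (-B) := by rw [← Real.exp_add]; ring_nf
  have htype2 : ∀ X ∈ Theta s₁ s₂ d₁ d₂ μ,
      obsLaw X {Y | thresholdTest (scanStat (d₁ := d₁) k F) h Y = 0} ≤
        ENNReal.ofReal (Real.exp (-B)) := by
    rintro X ⟨S₁, S₂, hS₁, hS₂, hX⟩
    obtain ⟨J, hSJ, -, hJk⟩ := Finset.exists_subsuperset_card_eq (n := k) (Finset.subset_univ S₁)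
      (by omega) (by simpa using hkd)
    have hle := obsLaw_colSum_mem X (hJne ⟨J, hJk⟩)
      (measurableSet_le hF measurable_const : MeasurableSet {z | F z ≤ h})
    calc _ ≤ obsLaw X {Y | F (fun j => colSum Y J j) ≤ h} := by
          refine measure_mono fun Y hY => ?_
          exact (le_ciSup (f := fun J : {J : Finset (Fin d₁) // J.card = k} =>
            F fun j => colSum Y J.1 j) (Set.finite_range _).bddAbove ⟨J, hJk⟩).trans
            ((hzero Y).1 hY)
      _ = _ := hle
      _ ≤ _ := halt S₂ hS₂ _ (fun j hj => by
          have := le_colSum_of_mem_ThetaOn hX hSJ hj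
          rwa [hS₁, hJk] at this) fun j hj => colSum_eq_zero_of_mem_ThetaOn hX J hj
  rw [two_mul, ENNReal.ofReal_add (Real.exp_pos _).le (Real.exp_pos _).le]
  exact add_le_add htype1 (iSup₂_le htype2)

lemma pi_lt_sum_truncSq_le {d : ℕ} {τ lam : ℝ} (hτ : 0 ≤ τ) (hlam : 0 ≤ lam)
    (hlam' : lam ≤ 1 / 40) (h : ℝ) :
    (Measure.pi fun _ : Fin d => gaussianReal 0 1) {z | h < ∑ j, truncSq τ (z j)} ≤
      ENNReal.ofReal (Real.exp (d * (12800 * lam ^ 2 * Real.exp (-τ ^ 2 / 8)) - lam * h)) := by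
  have := pi_le_sum_le (gaussianReal 0 1) (ι := Fin d) (f := fun _ z => lam * truncSq τ z)
    (fun _ => by fun_prop)
    (fun _ => lintegral_exp_mul_truncSq_le hτ (abs_le.2 ⟨by linarith, hlam'⟩))
    (lam * h)
  rw [Finset.sum_const, Finset.card_univ, Fintype.card_fin, nsmul_eq_mul] at this
  refine (measure_mono fun z hz => ?_).trans this
  simp only [Set.mem_ofPred_eq, ← Finset.mul_sum] at hz ⊢
  gcongr

lemma pi_sum_truncSq_add_le {d : ℕ} {τ lam θ : ℝ} (hτ : 0 ≤ τ) (hlam : 0 ≤ lam)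
    (hlam' : lam ≤ 1 / 40) (hθ : 0 ≤ θ) (h : ℝ) {S : Finset (Fin d)} {a : Fin d → ℝ}
    (ha : ∀ j ∈ S, θ ≤ a j) (ha' : ∀ j ∉ S, a j = 0) :
    (Measure.pi fun _ : Fin d => gaussianReal 0 1) {z | ∑ j, truncSq τ (a j + z j) ≤ h} ≤
      ENNReal.ofReal (Real.exp (d * (12800 * lam ^ 2 * Real.exp (-τ ^ 2 / 8)) + lam * h -
        S.card * (lam * (θ ^ 2 / 2 - 5 * τ ^ 2 - 12)))) := by
  classical
  set v := 12800 * lam ^ 2 * Real.exp (-τ ^ 2 / 8) with hv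
  have hv0 : 0 ≤ v := by positivity
  have hbound := pi_le_sum_le (gaussianReal 0 1) (ι := Fin d)
    (f := fun j z => -lam * truncSq τ (a j + z))
    (a := fun j => v + if j ∈ S then -lam * (θ ^ 2 / 2 - 5 * τ ^ 2 - 12) else 0)
    (fun _ => by fun_prop) (fun j => by
      by_cases hj : j ∈ S
      · simp only [hj, if_true]
        refine (lintegral_exp_neg_mul_truncSq_add_le hτ hlam hlam' hθ (ha j hj)).trans ?_
        gcongr
        linarith
      · simp only [hj, if_false, add_zero, ha' j hj, zero_add]
        refine (lintegral_exp_mul_truncSq_le (lam := -lam) hτ ?_).trans_eq ?_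
        · rw [abs_neg]; exact abs_le.2 ⟨by linarith, hlam'⟩
        · rw [neg_sq])
    (-lam * h)
  refine (measure_mono fun z hz => ?_).trans (hbound.trans_eq ?_)
  · simp only [Set.mem_ofPred_eq, ← Finset.mul_sum] at hz ⊢
    nlinarith
  · rw [Finset.sum_add_distrib, Finset.sum_ite_mem]
    simp only [Finset.sum_const, Finset.card_univ, Fintype.card_fin, nsmul_eq_mul,
      Finset.univ_inter]
    ring_nf

lemma half_le_log_one_add {x : ℝ} (hx : 1 ≤ x) : 1 / 2 ≤ Real.log (1 + x) := by
  have h2 : Real.log 2 ≤ Real.log (1 + x) := Real.log_le_log (by norm_num) (by linarith)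
  linarith [Real.log_two_gt_d9]

lemma half_mul_le_log_one_add {x : ℝ} (hx : 0 ≤ x) (hx' : x ≤ 1) :
    x / 2 ≤ Real.log (1 + x) := by
  have h := Real.one_sub_inv_le_log_of_pos (show 0 < 1 + x by linarith)
  refine le_trans ?_ h
  rw [show 1 - (1 + x)⁻¹ = x / (1 + x) by field_simp; ring]
  gcongr
  linarith

/-- The truncation level `τ² = 8 log (1 + d x / s²)` makes the total variance proxy of `d` null
columns at most `s² / x`. -/
lemma mul_exp_neg_truncation_le {d s x : ℝ} (hd : 0 ≤ d) (hs : 0 < s) (hx : 0 < x) :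
    d * Real.exp (-(Real.sqrt (8 * Real.log (1 + d / s ^ 2 * x))) ^ 2 / 8) ≤ s ^ 2 / x := by
  have h1 : 1 ≤ 1 + d / s ^ 2 * x := by
    have : 0 ≤ d / s ^ 2 * x := by positivity
    linarith
  rw [Real.sq_sqrt (by have := Real.log_nonneg h1; positivity),
    show -(8 * Real.log (1 + d / s ^ 2 * x)) / 8 = -Real.log (1 + d / s ^ 2 * x) by ring,
    Real.exp_neg, Real.exp_log (by linarith), ← div_eq_mul_inv, div_le_div_iff₀ (by linarith) hx,
    mul_add, mul_one, ← mul_assoc, mul_div_cancel₀ _ (by positivity)]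
  have : 0 ≤ s ^ 2 := by positivity
  linarith

/-- The scan test with the truncated chi-square statistic. -/
lemma risk_scan_truncSq_le {s₁ s₂ k d₁ d₂ : ℕ} {μ h A B : ℝ}
    (hs₁ : 1 ≤ s₁) (hs₁k : s₁ ≤ k) (hkd : k ≤ d₁) (hs₂ : 1 ≤ s₂) (hμ : 0 ≤ μ) (hB : 0 ≤ B)
    (hx : 1 ≤ (d₂ : ℝ) / (s₂ : ℝ) ^ 2 * logBinom d₁ k)
    (hh : 80 * (9 + B) * (s₂ * Real.log (1 + (d₂ : ℝ) / (s₂ : ℝ) ^ 2 * logBinom d₁ k)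
      + logBinom d₁ k) ≤ h)
    (hh' : h ≤ A * (s₂ * Real.log (1 + (d₂ : ℝ) / (s₂ : ℝ) ^ 2 * logBinom d₁ k)
      + logBinom d₁ k))
    (hsig : (4 * A + 2880 + 320 * B) * Real.log (1 + (d₂ : ℝ) / (s₂ : ℝ) ^ 2 * logBinom d₁ k) ≤
      (s₁ * μ / Real.sqrt k) ^ 2)
    (hsig' : (4 * A + 2880 + 320 * B) * (logBinom d₁ k / s₂) ≤ (s₁ * μ / Real.sqrt k) ^ 2) :
    risk s₁ s₂ (thresholdTest (scanStat (d₁ := d₁) (d₂ := d₂) k fun z => ∑ j, truncSq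
      (Real.sqrt (8 * Real.log (1 + (d₂ : ℝ) / (s₂ : ℝ) ^ 2 * logBinom d₁ k))) (z j)) h) μ ≤
      ENNReal.ofReal (2 * Real.exp (-B)) := by
  set L := logBinom d₁ k with hL
  set l := Real.log (1 + (d₂ : ℝ) / (s₂ : ℝ) ^ 2 * L) with hl
  set τ := Real.sqrt (8 * l) with hτ
  set θ := (s₁ : ℝ) * μ / Real.sqrt k with hθ
  have hL1 : 1 ≤ L := one_le_logBinom hkd
  have hl1 : 1 / 2 ≤ l := half_le_log_one_add hx
  have hs : (1 : ℝ) ≤ s₂ := by exact_mod_cast hs₂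
  have hτ0 : 0 ≤ τ := Real.sqrt_nonneg _
  have hτ2 : τ ^ 2 = 8 * l := Real.sq_sqrt (by positivity)
  have hθ0 : 0 ≤ θ := by positivity
  have hv : (d₂ : ℝ) * Real.exp (-τ ^ 2 / 8) ≤ (s₂ : ℝ) ^ 2 / L :=
    mul_exp_neg_truncation_le (Nat.cast_nonneg _) (by linarith) (by linarith)
  refine risk_scanStat_le hs₁ hs₁k hkd (by fun_prop) ?_ ?_
  · -- This exponent makes the gain of order `L` and the variance term of the same order.
    set lam := 1 / 40 * (L / (s₂ + L)) with hlam
    have hlam0 : 0 ≤ lam := by positivity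
    have hlam1 : lam ≤ 1 / 40 := by
      have : L / (s₂ + L) ≤ 1 := (div_le_one (by positivity)).2 (by linarith)
      linarith
    refine (pi_lt_sum_truncSq_le hτ0 hlam0 hlam1 h).trans ?_
    gcongr
    have hgain : (18 + 2 * B) / 2 * L ≤ lam * h := by
      have : 80 * (9 + B) * ((s₂ + L) / 2) ≤ h := by
        refine le_trans ?_ hh
        gcongr
        nlinarith
      calc (18 + 2 * B) / 2 * L = lam * (80 * (9 + B) * ((s₂ + L) / 2)) := by
            rw [hlam]
            field_simp
            ring
        _ ≤ lam * h := by gcongr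
    have hvar : (d₂ : ℝ) * (12800 * lam ^ 2 * Real.exp (-τ ^ 2 / 8)) ≤ 8 * L := by
      have h1 : L / (s₂ + L) * s₂ ≤ L := by
        rw [div_mul_eq_mul_div, div_le_iff₀ (by positivity)]
        nlinarith
      calc (d₂ : ℝ) * (12800 * lam ^ 2 * Real.exp (-τ ^ 2 / 8))
          = 12800 * lam ^ 2 * ((d₂ : ℝ) * Real.exp (-τ ^ 2 / 8)) := by ring
        _ ≤ 12800 * lam ^ 2 * ((s₂ : ℝ) ^ 2 / L) := by gcongr
        _ = 8 * (L / (s₂ + L) * s₂) ^ 2 / L := by rw [hlam]; ring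
        _ ≤ 8 * L ^ 2 / L := by gcongr
        _ = 8 * L := by field_simp
    nlinarith
  · intro S₂ hS₂ a ha ha'
    set lam := 1 / (40 * (s₂ : ℝ)) with hlam
    have hlam0 : 0 ≤ lam := by positivity
    have hlam1 : lam ≤ 1 / 40 := by
      rw [hlam]
      gcongr
      linarith
    refine (pi_sum_truncSq_add_le hτ0 hlam0 hlam1 hθ0 h ha ha').trans ?_
    gcongr
    rw [hS₂]
    have hvar : (d₂ : ℝ) * (12800 * lam ^ 2 * Real.exp (-τ ^ 2 / 8)) ≤ 8 := by
      calc (d₂ : ℝ) * (12800 * lam ^ 2 * Real.exp (-τ ^ 2 / 8))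
          = 12800 * lam ^ 2 * ((d₂ : ℝ) * Real.exp (-τ ^ 2 / 8)) := by ring
        _ ≤ 12800 * lam ^ 2 * ((s₂ : ℝ) ^ 2 / L) := by gcongr
        _ = 8 / L := by rw [hlam]; field_simp; norm_num
        _ ≤ 8 := div_le_self (by norm_num) hL1
    have hcut : lam * h ≤ A / 40 * (l + L / s₂) := by
      calc lam * h ≤ lam * (A * (s₂ * l + L)) := by gcongr
        _ = A / 40 * (l + L / s₂) := by rw [hlam]; field_simp
    have hsl : (s₂ : ℝ) * (lam * (θ ^ 2 / 2 - 5 * (8 * l) - 12)) =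
        1 / 40 * (θ ^ 2 / 2 - 5 * (8 * l) - 12) := by
      rw [hlam]; field_simp
    rw [← hτ2] at hsl
    rw [hsl]
    have hq : 0 ≤ L / s₂ := by positivity
    nlinarith [mul_nonneg hB hq, mul_nonneg hB (show 0 ≤ l - 1 / 2 by linarith)]

/-- The scan test with the linear statistic. -/
lemma risk_scan_linear_le {s₁ s₂ k d₁ d₂ : ℕ} {μ h B : ℝ}
    (hs₁ : 1 ≤ s₁) (hs₁k : s₁ ≤ k) (hkd : k ≤ d₁) (hd₂ : 1 ≤ d₂) (hB : 0 ≤ B)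
    (hh0 : 0 ≤ h) (hh : h ^ 2 = 2 * (1 + B) * logBinom d₁ k) (hμ : 0 ≤ μ)
    (hsig : 4 * h ^ 2 ≤ (s₁ * μ / Real.sqrt k) ^ 2 * ((s₂ : ℝ) ^ 2 / d₂)) :
    risk s₁ s₂ (thresholdTest (scanStat (d₁ := d₁) (d₂ := d₂) k fun z =>
      1 / Real.sqrt (d₂ : ℝ) * ∑ j, z j) h) μ ≤ ENNReal.ofReal (2 * Real.exp (-B)) := by
  have hL1 : 1 ≤ logBinom d₁ k := one_le_logBinom hkd
  have hd : (0 : ℝ) < d₂ := by exact_mod_cast hd₂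
  have hF : Measurable fun z : Fin d₂ → ℝ => 1 / Real.sqrt (d₂ : ℝ) * ∑ j, z j := by fun_prop
  have hlaw : (Measure.pi fun _ : Fin d₂ => gaussianReal 0 1).map
      (fun z => 1 / Real.sqrt (d₂ : ℝ) * ∑ j, z j) = gaussianReal 0 1 := by
    have : (Finset.univ : Finset (Fin d₂)).Nonempty := ⟨⟨0, hd₂⟩, Finset.mem_univ _⟩
    simpa using map_normalized_sum_pi_gaussianReal _ this
  have htail : ∀ S : Set ℝ, MeasurableSet S → (Measure.pi fun _ : Fin d₂ => gaussianReal 0 1)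
      {z | 1 / Real.sqrt (d₂ : ℝ) * ∑ j, z j ∈ S} = gaussianReal 0 1 S := fun S hS => by
    conv_rhs => rw [← hlaw]
    exact (Measure.map_apply hF hS).symm
  refine risk_scanStat_le hs₁ hs₁k hkd hF ?_ ?_
  · refine (htail (Set.Ioi h) measurableSet_Ioi).trans_le ?_
    refine (measure_mono Set.Ioi_subset_Ici_self).trans ((gaussianReal_le_exp hh0).trans ?_)
    gcongr
    rw [hh]
    nlinarith
  · intro S₂ hS₂ a ha ha'
    set θ := (s₁ : ℝ) * μ / Real.sqrt k with hθ
    have hθ0 : 0 ≤ θ := by positivity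
    have hsum : (s₂ : ℝ) * θ ≤ ∑ j, a j := by
      rw [← Finset.sum_subset (Finset.subset_univ S₂) fun j _ hj => ha' j hj, ← hS₂,
        ← nsmul_eq_mul]
      exact Finset.card_nsmul_le_sum _ _ _ ha
    have hmean : 2 * h ≤ 1 / Real.sqrt (d₂ : ℝ) * ∑ j, a j := by
      calc 2 * h ≤ 1 / Real.sqrt (d₂ : ℝ) * (s₂ * θ) := by
            refine abs_le_of_sq_le_sq' ?_ (by positivity) |>.2
            rw [mul_pow, mul_pow, div_pow, Real.sq_sqrt hd.le]
            refine le_of_eq_of_le (by ring) (hsig.trans_eq ?_)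
            field_simp
        _ ≤ _ := by gcongr
    have hneg : gaussianReal 0 1 (Set.Iic (-h)) = gaussianReal 0 1 (Set.Ici h) := by
      have hmap := gaussianReal_map_neg (μ := 0) (v := 1)
      rw [neg_zero] at hmap
      conv_rhs => rw [← hmap]
      rw [Measure.map_apply (by fun_prop) measurableSet_Ici]
      congr 1
      ext z
      simp only [Set.mem_Iic, Set.mem_preimage, Set.mem_Ici]
      exact le_neg
    calc _ ≤ (Measure.pi fun _ : Fin d₂ => gaussianReal 0 1)
          {z | 1 / Real.sqrt (d₂ : ℝ) * ∑ j, z j ∈ Set.Iic (-h)} := by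
          refine measure_mono fun z hz => ?_
          simp only [Set.mem_ofPred_eq, Finset.sum_add_distrib, mul_add, Set.mem_Iic] at hz ⊢
          linarith
      _ = gaussianReal 0 1 (Set.Ici h) := (htail _ measurableSet_Iic).trans hneg
      _ ≤ ENNReal.ofReal (Real.exp (-h ^ 2 / 2)) := gaussianReal_le_exp hh0
      _ ≤ _ := by
          gcongr
          rw [hh]
          nlinarith

lemma maxTruncChiStat_eq_scanStat {d₁ d₂ : ℕ} (k : ℕ) (τ : ℝ) :
    maxTruncChiStat (d₁ := d₁) (d₂ := d₂) k τ = scanStat k fun z => ∑ j, truncSq τ (z j) := rfl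

lemma maxLinStat_eq_scanStat {d₁ d₂ : ℕ} (k : ℕ) :
    maxLinStat (d₁ := d₁) (d₂ := d₂) k =
      scanStat k fun z => 1 / Real.sqrt (d₂ : ℝ) * ∑ j, z j := rfl

lemma measurable_testC (K : ℝ) (s₁ s₂ : ℕ) {d₁ d₂ : ℕ} (h h' : ℝ) :
    Measurable (testC K s₁ s₂ h h' : Matrix (Fin d₁) (Fin d₂) ℝ → Fin 2) := by
  unfold testC maxTruncChiTest
  rw [maxTruncChiStat_eq_scanStat, maxLinStat_eq_scanStat]
  split_ifs
  · exact measurable_thresholdTest (measurable_scanStat _ (by fun_prop)) _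
  · exact measurable_thresholdTest (measurable_scanStat _ (by fun_prop)) _

/-- Risk of the combined scan test over sets of `k ≥ s₁` rows. The case `k = s₁` is the Bonferroni
corrected test, the case `k = d₁` is the test based on the full column sums. -/
lemma risk_testC_le {s₁ s₂ k d₁ d₂ : ℕ} {μ h h' A B : ℝ}
    (hs₁ : 1 ≤ s₁) (hs₁k : s₁ ≤ k) (hkd : k ≤ d₁) (hs₂ : 1 ≤ s₂) (hsd₂ : s₂ ≤ d₂) (hμ : 0 ≤ μ)
    (hB : 0 ≤ B) (hA : 0 ≤ A)
    (hh : 1 ≤ (d₂ : ℝ) / (s₂ : ℝ) ^ 2 * logBinom d₁ k →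
      80 * (9 + B) * (s₂ * Real.log (1 + (d₂ : ℝ) / (s₂ : ℝ) ^ 2 * logBinom d₁ k)
        + logBinom d₁ k) ≤ h)
    (hhA : 1 ≤ (d₂ : ℝ) / (s₂ : ℝ) ^ 2 * logBinom d₁ k →
      h ≤ A * (s₂ * Real.log (1 + (d₂ : ℝ) / (s₂ : ℝ) ^ 2 * logBinom d₁ k) + logBinom d₁ k))
    (hh' : h' = Real.sqrt (2 * (1 + B)) * Real.sqrt (logBinom d₁ k))
    (hsig : (4 * A + 2880 + 320 * B) * Real.log (1 + (d₂ : ℝ) / (s₂ : ℝ) ^ 2 * logBinom d₁ k) ≤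
      (s₁ * μ / Real.sqrt k) ^ 2)
    (hsig' : 1 ≤ (d₂ : ℝ) / (s₂ : ℝ) ^ 2 * logBinom d₁ k →
      (4 * A + 2880 + 320 * B) * (logBinom d₁ k / s₂) ≤ (s₁ * μ / Real.sqrt k) ^ 2) :
    risk s₁ s₂ (testC 8 k s₂ h h' : Matrix (Fin d₁) (Fin d₂) ℝ → Fin 2) μ ≤
      ENNReal.ofReal (2 * Real.exp (-B)) := by
  have hL1 : 1 ≤ logBinom d₁ k := one_le_logBinom hkd
  by_cases hx : 1 ≤ (d₂ : ℝ) / (s₂ : ℝ) ^ 2 * logBinom d₁ k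
  · rw [testC, if_pos hx, maxTruncChiTest, maxTruncChiStat_eq_scanStat]
    exact risk_scan_truncSq_le hs₁ hs₁k hkd hs₂ hμ hB hx (hh hx) (hhA hx) hsig (hsig' hx)
  · rw [testC, if_neg hx, maxLinStat_eq_scanStat]
    have hs : (0 : ℝ) < s₂ := by exact_mod_cast hs₂
    have hd : (0 : ℝ) < d₂ := by exact_mod_cast hs₂.trans hsd₂
    have hsq : h' ^ 2 = 2 * (1 + B) * logBinom d₁ k := by
      rw [hh', mul_pow, Real.sq_sqrt (by linarith), Real.sq_sqrt (by linarith)]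
    refine risk_scan_linear_le hs₁ hs₁k hkd (hs₂.trans hsd₂) hB (by rw [hh']; positivity) hsq hμ ?_
    have hlog := half_mul_le_log_one_add (x := (d₂ : ℝ) / (s₂ : ℝ) ^ 2 * logBinom d₁ k)
      (by positivity) (not_le.1 hx).le
    have hC : 0 ≤ 4 * A + 2880 + 320 * B := by linarith
    calc 4 * h' ^ 2 = 8 * (1 + B) * logBinom d₁ k := by rw [hsq]; ring
      _ ≤ (4 * A + 2880 + 320 * B) / 2 * logBinom d₁ k := by gcongr; linarith
      _ = (4 * A + 2880 + 320 * B) * ((d₂ : ℝ) / (s₂ : ℝ) ^ 2 * logBinom d₁ k / 2) *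
          ((s₂ : ℝ) ^ 2 / d₂) := by field_simp
      _ ≤ (s₁ * μ / Real.sqrt k) ^ 2 * ((s₂ : ℝ) ^ 2 / d₂) := by
          gcongr
          exact (mul_le_mul_of_nonneg_left hlog hC).trans hsig

/-! ### Reductions between the tests -/

lemma logBinom_self (d : ℕ) : logBinom d d = 1 := by simp [logBinom]

lemma scanStat_self {d₁ d₂ : ℕ} (F : (Fin d₂ → ℝ) → ℝ) (Y : Matrix (Fin d₁) (Fin d₂) ℝ) :
    scanStat d₁ F Y = F fun j => colSum Y Finset.univ j := by
  have hall : ∀ J : {J : Finset (Fin d₁) // J.card = d₁}, J.1 = Finset.univ := fun J =>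
    Finset.card_eq_iff_eq_univ _ |>.1 (by simpa using J.2)
  have : Nonempty {J : Finset (Fin d₁) // J.card = d₁} := ⟨⟨Finset.univ, by simp⟩⟩
  rw [scanStat]
  simp only [hall, ciSup_const]

lemma linStat_eq_sum_colSum {d₁ d₂ : ℕ} (Y : Matrix (Fin d₁) (Fin d₂) ℝ) :
    linStat Y = 1 / Real.sqrt (d₂ : ℝ) * ∑ j, colSum Y Finset.univ j := by
  simp only [linStat, colSum, Finset.card_univ, Fintype.card_fin]
  rw [← Finset.mul_sum, Finset.sum_comm, Real.sqrt_mul (Nat.cast_nonneg _), ← mul_assoc]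
  congr 1
  rw [one_div_mul_one_div, mul_comm]

/-- A scan over sets of `d₁` rows is no scan at all, and costs no logarithmic factor. -/
lemma testA_eq_testC (K : ℝ) (s₂ : ℕ) {d₁ d₂ : ℕ} (h h' : ℝ) :
    (testA K s₂ h h' : Matrix (Fin d₁) (Fin d₂) ℝ → Fin 2) = testC K d₁ s₂ h h' := by
  have hlin : (linStat : Matrix (Fin d₁) (Fin d₂) ℝ → ℝ) = maxLinStat d₁ := by
    ext Y
    rw [maxLinStat_eq_scanStat, scanStat_self, linStat_eq_sum_colSum]
  have hchi : ∀ τ, (truncChiStat τ : Matrix (Fin d₁) (Fin d₂) ℝ → ℝ) = maxTruncChiStat d₁ τ := by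
    intro τ
    ext Y
    rw [maxTruncChiStat_eq_scanStat, scanStat_self, truncChiStat]
  simp only [testA, testC, truncChiTest, maxTruncChiTest, logBinom_self, mul_one, hlin, hchi]

lemma map_transpose_obsLaw {d₁ d₂ : ℕ} (X : Matrix (Fin d₁) (Fin d₂) ℝ) :
    (obsLaw X).map Matrix.transpose = obsLaw Xᵀ := by
  rw [obsLaw, obsLaw, ← map_transpose_noiseLaw d₁ d₂,
    Measure.map_map (measurable_transpose _ _) (measurable_const_add_matrix X),
    Measure.map_map (measurable_const_add_matrix Xᵀ) (measurable_transpose _ _)]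
  rfl

lemma transpose_mem_Theta {s₁ s₂ d₁ d₂ : ℕ} {μ : ℝ} {X : Matrix (Fin d₁) (Fin d₂) ℝ}
    (hX : X ∈ Theta s₁ s₂ d₁ d₂ μ) : Xᵀ ∈ Theta s₂ s₁ d₂ d₁ μ := by
  obtain ⟨S₁, S₂, h₁, h₂, hge, hz⟩ := hX
  exact ⟨S₂, S₁, h₂, h₁, fun i j h => hge j i h.symm, fun i j h => hz j i fun h' => h h'.symm⟩

lemma risk_comp_transpose_le {s₁ s₂ d₁ d₂ : ℕ} {μ : ℝ} {T : Matrix (Fin d₂) (Fin d₁) ℝ → Fin 2}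
    (hT : Measurable T) :
    risk s₁ s₂ (fun Y : Matrix (Fin d₁) (Fin d₂) ℝ => T Yᵀ) μ ≤ risk s₂ s₁ T μ := by
  have hlaw : ∀ (X : Matrix (Fin d₁) (Fin d₂) ℝ) (i : Fin 2),
      obsLaw X {Y | T Yᵀ = i} = obsLaw Xᵀ {Y | T Y = i} := fun X i => by
    rw [← map_transpose_obsLaw]
    exact (Measure.map_apply (measurable_transpose _ _) (hT (measurableSet_singleton i))).symm
  refine add_le_add ?_ (iSup₂_le fun X hX => ?_)
  · rw [hlaw, Matrix.transpose_zero]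
  · rw [hlaw]
    exact le_iSup₂ (f := fun X' (_ : X' ∈ Theta s₂ s₁ d₂ d₁ μ) => obsLaw X' {Y | T Y = 0}) _
      (transpose_mem_Theta hX)

/-! ### Comparison of the rates -/

lemma choose_le_pow {d s : ℕ} (hs : 1 ≤ s) :
    (d.choose s : ℝ) ≤ (Real.exp 1 * (d / s)) ^ s := by
  have hs0 : (0 : ℝ) < s := by exact_mod_cast hs
  have h1 := Nat.choose_le_pow_div (α := ℝ) s d
  have h2 := Real.pow_div_factorial_le_exp (s : ℝ) hs0.le s
  refine h1.trans ?_
  rw [mul_pow, ← Real.exp_nat_mul, mul_one, div_pow]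
  calc (d : ℝ) ^ s / (s.factorial : ℝ) = (s : ℝ) ^ s / (s.factorial : ℝ) * (d ^ s / s ^ s) := by
        field_simp
    _ ≤ _ := by gcongr

lemma pow_le_choose {d s : ℕ} (hsd : s ≤ d) : ((d : ℝ) / s) ^ s ≤ d.choose s := by
  induction s generalizing d with
  | zero => simp
  | succ s ih =>
    obtain ⟨d, rfl⟩ : ∃ e, d = e + 1 := ⟨d - 1, by omega⟩
    have hsd' : s ≤ d := by omega
    have hrec : ((d + 1 : ℕ) : ℝ) * d.choose s = (d + 1).choose (s + 1) * ((s + 1 : ℕ) : ℝ) := by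
      exact_mod_cast Nat.add_one_mul_choose_eq d s
    have hs0 : (0 : ℝ) < ((s + 1 : ℕ) : ℝ) := by positivity
    have hpow : (((d + 1 : ℕ) : ℝ) / ((s + 1 : ℕ) : ℝ)) ^ s ≤ ((d : ℝ) / s) ^ s := by
      rcases Nat.eq_zero_or_pos s with rfl | hs
      · simp
      · have : (0 : ℝ) < s := by exact_mod_cast hs
        have : (s : ℝ) ≤ d := by exact_mod_cast hsd'
        gcongr ?_ ^ s
        rw [div_le_div_iff₀ hs0 (by assumption)]
        push_cast
        linarith
    calc (((d + 1 : ℕ) : ℝ) / ((s + 1 : ℕ) : ℝ)) ^ (s + 1)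
        = (((d + 1 : ℕ) : ℝ) / ((s + 1 : ℕ) : ℝ)) ^ s *
          (((d + 1 : ℕ) : ℝ) / ((s + 1 : ℕ) : ℝ)) := pow_succ _ _
      _ ≤ d.choose s * (((d + 1 : ℕ) : ℝ) / ((s + 1 : ℕ) : ℝ)) := by
          gcongr
          exact hpow.trans (ih hsd')
      _ = (d + 1).choose (s + 1) := by
          rw [mul_div_assoc', mul_comm, hrec]
          field_simp

lemma log_choose_le {d s : ℕ} (hs : 1 ≤ s) (hsd : s ≤ d) :
    Real.log (d.choose s) ≤ s * (1 + Real.log (d / s)) := by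
  have hs0 : (0 : ℝ) < s := by exact_mod_cast hs
  have hd0 : (0 : ℝ) < d := by exact_mod_cast hs.trans hsd
  have hc : (0 : ℝ) < d.choose s := by exact_mod_cast Nat.choose_pos hsd
  refine (Real.log_le_log hc (choose_le_pow hs)).trans_eq ?_
  rw [Real.log_pow, Real.log_mul (Real.exp_pos 1).ne' (by positivity), Real.log_exp]

lemma le_logBinom_of_exp_one_mul_le {d s : ℕ} (hs : 1 ≤ s) (hsd : s ≤ d)
    (h : Real.exp 1 * s ≤ d) : (s : ℝ) ≤ logBinom d s := by
  have hs0 : (0 : ℝ) < s := by exact_mod_cast hs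
  have h1 : Real.exp 1 ≤ (d : ℝ) / s := (le_div_iff₀ hs0).2 h
  have h2 : Real.exp s ≤ d.choose s := by
    calc Real.exp s = Real.exp 1 ^ s := by rw [← Real.exp_nat_mul, mul_one]
      _ ≤ ((d : ℝ) / s) ^ s := by gcongr
      _ ≤ _ := pow_le_choose hsd
  have h3 := (Real.le_log_iff_exp_le (by exact_mod_cast Nat.choose_pos hsd)).2 h2
  linarith [log_choose_eq hsd]

lemma psiRate_nonneg {s₁ s₂ d₁ d₂ : ℕ} (h : s₁ ≤ d₁) : 0 ≤ psiRate s₁ s₂ d₁ d₂ := by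
  have := one_le_logBinom h
  have : 0 ≤ (d₂ : ℝ) / (s₂ : ℝ) ^ 2 * logBinom d₁ s₁ := by positivity
  have := Real.log_nonneg (show 1 ≤ 1 + (d₂ : ℝ) / (s₂ : ℝ) ^ 2 * logBinom d₁ s₁ by linarith)
  unfold psiRate
  positivity

/-- With at most `e * s₁` rows, scanning over the rows gains nothing over the full column sums. -/
lemma phiRate_le_psiRate {s₁ s₂ d₁ d₂ : ℕ} (hs₁ : 1 ≤ s₁) (hsd₁ : s₁ ≤ d₁)
    (h : (d₁ : ℝ) ≤ Real.exp 1 * s₁) : phiRate s₁ s₂ d₁ d₂ ≤ 3 * psiRate s₁ s₂ d₁ d₂ := by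
  have hs0 : (0 : ℝ) < s₁ := by exact_mod_cast hs₁
  have hL := one_le_logBinom hsd₁
  have hx : 0 ≤ (d₂ : ℝ) / (s₂ : ℝ) ^ 2 := by positivity
  have hlog : Real.log (1 + (d₂ : ℝ) / (s₂ : ℝ) ^ 2) ≤
      Real.log (1 + (d₂ : ℝ) / (s₂ : ℝ) ^ 2 * logBinom d₁ s₁) :=
    Real.log_le_log (by linarith) (by nlinarith)
  have hlog0 : 0 ≤ Real.log (1 + (d₂ : ℝ) / (s₂ : ℝ) ^ 2) := Real.log_nonneg (by linarith)
  have hd : (d₁ : ℝ) / (s₁ : ℝ) ^ 2 ≤ 3 * (1 / s₁) := by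
    rw [mul_one_div, div_le_div_iff₀ (by positivity) hs0]
    nlinarith [Real.exp_one_lt_d9]
  calc phiRate s₁ s₂ d₁ d₂ ≤ 3 * (1 / s₁) * Real.log (1 + (d₂ : ℝ) / (s₂ : ℝ) ^ 2) := by
        unfold phiRate; gcongr
    _ ≤ 3 * (1 / s₁) * Real.log (1 + (d₂ : ℝ) / (s₂ : ℝ) ^ 2 * logBinom d₁ s₁) := by gcongr
    _ = _ := by unfold psiRate; ring

lemma betaRate_le_psiRate {s₁ s₂ d₁ d₂ : ℕ} (hs₁ : 1 ≤ s₁) (hsd₁ : s₁ ≤ d₁)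
    (h : Real.exp 1 * s₁ ≤ d₁) (hL : (s₁ : ℝ) ≤ logBinom d₂ s₂) :
    betaRate s₂ s₁ d₂ d₁ ≤ 2 * psiRate s₂ s₁ d₂ d₁ := by
  have hs0 : (0 : ℝ) < s₁ := by exact_mod_cast hs₁
  have hd0 : (0 : ℝ) < d₁ := by exact_mod_cast hs₁.trans hsd₁
  have h1 : Real.exp 1 ≤ (d₁ : ℝ) / s₁ := (le_div_iff₀ hs0).2 h
  have hlog1 : 1 ≤ Real.log ((d₁ : ℝ) / s₁) := (Real.le_log_iff_exp_le (by positivity)).2 h1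
  have hle : Real.log ((d₁ : ℝ) / s₁) ≤
      Real.log (1 + (d₁ : ℝ) / (s₁ : ℝ) ^ 2 * logBinom d₂ s₂) := by
    refine Real.log_le_log (by positivity) ?_
    have : (d₁ : ℝ) / (s₁ : ℝ) ^ 2 * s₁ ≤ (d₁ : ℝ) / (s₁ : ℝ) ^ 2 * logBinom d₂ s₂ := by gcongr
    have he : (d₁ : ℝ) / (s₁ : ℝ) ^ 2 * s₁ = d₁ / s₁ := by field_simp
    linarith
  have hch0 : 0 ≤ Real.log (d₁.choose s₁ : ℝ) :=
    Real.log_nonneg (by exact_mod_cast Nat.choose_pos hsd₁)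
  have hch := log_choose_le hs₁ hsd₁
  calc betaRate s₂ s₁ d₂ d₁ ≤ 1 / ((s₂ : ℝ) * s₁) * Real.log (d₁.choose s₁ : ℝ) := by
        refine mul_le_of_le_one_right (by positivity) ?_
        split_ifs <;> norm_num
    _ ≤ 1 / ((s₂ : ℝ) * s₁) * (s₁ * (1 + Real.log ((d₁ : ℝ) / s₁))) := by gcongr
    _ = 1 / (s₂ : ℝ) * (1 + Real.log ((d₁ : ℝ) / s₁)) := by
        rw [one_div_mul_eq_div, one_div_mul_eq_div, mul_comm (s₂ : ℝ), mul_div_mul_left _ _ hs0.ne']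
    _ ≤ 1 / (s₂ : ℝ) * (2 * Real.log (1 + (d₁ : ℝ) / (s₁ : ℝ) ^ 2 * logBinom d₂ s₂)) := by
        gcongr
        linarith
    _ = _ := by unfold psiRate; ring

/-- The Bonferroni terms `β` never dominate: if one dimension is comparable to its sparsity, then a
full sum is as good as a scan; otherwise `log (d choose s) ≥ s` in both directions, and the `β` of
the smaller sparsity is absorbed by a `ψ`. -/
lemma rTilde_le_separationRate {s₁ s₂ d₁ d₂ : ℕ} (hs₁ : 1 ≤ s₁) (hsd₁ : s₁ ≤ d₁) (hs₂ : 1 ≤ s₂)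
    (hsd₂ : s₂ ≤ d₂) : rTilde s₁ s₂ d₁ d₂ ≤ 3 * separationRate s₁ s₂ d₁ d₂ := by
  have hφ : ∀ {s₁ s₂ d₁ d₂ : ℕ}, 0 ≤ phiRate s₁ s₂ d₁ d₂ := by
    intro s₁ s₂ d₁ d₂
    have : 0 ≤ (d₂ : ℝ) / (s₂ : ℝ) ^ 2 := by positivity
    have := Real.log_nonneg (show 1 ≤ 1 + (d₂ : ℝ) / (s₂ : ℝ) ^ 2 by linarith)
    unfold phiRate
    positivity
  have h12 := psiRate_nonneg (s₂ := s₂) (d₂ := d₂) hsd₁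
  have h21 := psiRate_nonneg (s₂ := s₁) (d₂ := d₁) hsd₂
  have r1 : rTilde s₁ s₂ d₁ d₂ ≤ psiRate s₁ s₂ d₁ d₂ + betaRate s₂ s₁ d₂ d₁ := min_le_left _ _
  have r2 : rTilde s₁ s₂ d₁ d₂ ≤ psiRate s₂ s₁ d₂ d₁ + betaRate s₁ s₂ d₁ d₂ :=
    (min_le_right _ _).trans (min_le_left _ _)
  have r3 : rTilde s₁ s₂ d₁ d₂ ≤ phiRate s₁ s₂ d₁ d₂ :=
    (min_le_right _ _).trans ((min_le_right _ _).trans (min_le_left _ _))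
  have r4 : rTilde s₁ s₂ d₁ d₂ ≤ phiRate s₂ s₁ d₂ d₁ :=
    (min_le_right _ _).trans ((min_le_right _ _).trans (min_le_right _ _))
  have hmain : rTilde s₁ s₂ d₁ d₂ ≤ 3 * (psiRate s₁ s₂ d₁ d₂ + psiRate s₂ s₁ d₂ d₁) := by
    rcases le_total (d₁ : ℝ) (Real.exp 1 * s₁) with hd₁ | hd₁
    · linarith [phiRate_le_psiRate (s₂ := s₂) (d₂ := d₂) hs₁ hsd₁ hd₁]
    rcases le_total (d₂ : ℝ) (Real.exp 1 * s₂) with hd₂ | hd₂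
    · linarith [phiRate_le_psiRate (s₂ := s₁) (d₂ := d₁) hs₂ hsd₂ hd₂]
    have hL₁ := le_logBinom_of_exp_one_mul_le hs₁ hsd₁ hd₁
    have hL₂ := le_logBinom_of_exp_one_mul_le hs₂ hsd₂ hd₂
    rcases le_total s₁ s₂ with h | h
    · have h' : (s₁ : ℝ) ≤ s₂ := by exact_mod_cast h
      linarith [betaRate_le_psiRate hs₁ hsd₁ hd₁ (h'.trans hL₂)]
    · have h' : (s₂ : ℝ) ≤ s₁ := by exact_mod_cast h
      linarith [betaRate_le_psiRate hs₂ hsd₂ hd₂ (h'.trans hL₁)]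
  rw [separationRate, mul_min_of_nonneg _ _ (by norm_num), mul_min_of_nonneg _ _ (by norm_num)]
  refine le_min hmain (le_min ?_ ?_)
  · linarith [hφ (s₁ := s₁) (s₂ := s₂) (d₁ := d₁) (d₂ := d₂)]
  · linarith [hφ (s₁ := s₂) (s₂ := s₁) (d₁ := d₂) (d₂ := d₁)]

/-! ### Risk bounds in terms of the rates -/

lemma risk_testA_le {s₁ s₂ d₁ d₂ : ℕ} {μ A B : ℝ} (hs₁ : 1 ≤ s₁) (hsd₁ : s₁ ≤ d₁)
    (hs₂ : 1 ≤ s₂) (hsd₂ : s₂ ≤ d₂) (hμ : 0 ≤ μ) (hB : 0 ≤ B) (hA : A = 240 * (9 + B))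
    (hsig : 2 * (4 * A + 2880 + 320 * B) * phiRate s₁ s₂ d₁ d₂ ≤ μ ^ 2) :
    risk s₁ s₂ (testA 8 s₂ (A * (s₂ * Real.log (1 + (d₂ : ℝ) / (s₂ : ℝ) ^ 2)))
      (Real.sqrt (2 * (1 + B))) : Matrix (Fin d₁) (Fin d₂) ℝ → Fin 2) μ ≤
      ENNReal.ofReal (2 * Real.exp (-B)) := by
  have hs₁' : (0 : ℝ) < s₁ := by exact_mod_cast hs₁
  have hd₁' : (0 : ℝ) < d₁ := by exact_mod_cast hs₁.trans hsd₁
  have hs₂' : (1 : ℝ) ≤ s₂ := by exact_mod_cast hs₂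
  set l := Real.log (1 + (d₂ : ℝ) / (s₂ : ℝ) ^ 2) with hl
  have hx0 : 0 ≤ (d₂ : ℝ) / (s₂ : ℝ) ^ 2 := by positivity
  have hl0 : 0 ≤ l := Real.log_nonneg (by linarith)
  have hA0 : 0 ≤ A := by rw [hA]; linarith
  have hsig1 : 2 * (4 * A + 2880 + 320 * B) * l ≤ (s₁ * μ / Real.sqrt d₁) ^ 2 := by
    rw [div_pow, mul_pow, Real.sq_sqrt hd₁'.le]
    calc 2 * (4 * A + 2880 + 320 * B) * l
        = (s₁ : ℝ) ^ 2 * (2 * (4 * A + 2880 + 320 * B) * phiRate s₁ s₂ d₁ d₂) / d₁ := by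
          rw [phiRate, ← hl]; field_simp
      _ ≤ (s₁ : ℝ) ^ 2 * μ ^ 2 / d₁ := by gcongr
  rw [testA_eq_testC]
  refine risk_testC_le hs₁ hsd₁ le_rfl hs₂ hsd₂ hμ hB hA0 ?_ ?_ ?_ ?_ ?_ <;>
    simp only [logBinom_self, mul_one, ← hl]
  · intro hx
    have hl1 : 1 / 2 ≤ l := half_le_log_one_add hx
    -- The cutoff has no summand `logBinom d₁ d₁ = 1`; absorbing it costs the factor `3` in `A`.
    have : s₂ * l + 1 ≤ 3 * (s₂ * l) := by nlinarith
    calc 80 * (9 + B) * (s₂ * l + 1) ≤ 80 * (9 + B) * (3 * (s₂ * l)) := by gcongr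
      _ = A * (s₂ * l) := by rw [hA]; ring
  · intro _
    gcongr
    linarith
  · rw [Real.sqrt_one, mul_one]
  · refine le_trans ?_ hsig1
    nlinarith [show 0 ≤ (4 * A + 2880 + 320 * B) * l by positivity]
  · intro hx
    have hl1 : 1 / 2 ≤ l := half_le_log_one_add hx
    have : 1 / (s₂ : ℝ) ≤ 2 * l := (div_le_one (by linarith) |>.2 hs₂').trans (by linarith)
    calc (4 * A + 2880 + 320 * B) * (1 / (s₂ : ℝ)) ≤ (4 * A + 2880 + 320 * B) * (2 * l) := by
          gcongr
      _ ≤ _ := by linarith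

lemma risk_testC_self_le {s₁ s₂ d₁ d₂ : ℕ} {μ A B : ℝ} (hs₁ : 1 ≤ s₁) (hsd₁ : s₁ ≤ d₁)
    (hs₂ : 1 ≤ s₂) (hsd₂ : s₂ ≤ d₂) (hμ : 0 ≤ μ) (hB : 0 ≤ B) (hA : A = 240 * (9 + B))
    (hsig : 2 * (4 * A + 2880 + 320 * B) * (psiRate s₁ s₂ d₁ d₂ + betaRate s₂ s₁ d₂ d₁) ≤
      μ ^ 2) :
    risk s₁ s₂ (testC 8 s₁ s₂
      (A * (s₂ * Real.log (1 + (d₂ : ℝ) / (s₂ : ℝ) ^ 2 * logBinom d₁ s₁) + logBinom d₁ s₁))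
      (Real.sqrt (2 * (1 + B)) * Real.sqrt (logBinom d₁ s₁)) :
      Matrix (Fin d₁) (Fin d₂) ℝ → Fin 2) μ ≤ ENNReal.ofReal (2 * Real.exp (-B)) := by
  have hs₁' : (0 : ℝ) < s₁ := by exact_mod_cast hs₁
  have hs₂' : (1 : ℝ) ≤ s₂ := by exact_mod_cast hs₂
  have hsd₂' : (s₂ : ℝ) ≤ d₂ := by exact_mod_cast hsd₂
  have hL := one_le_logBinom hsd₁
  set L := logBinom d₁ s₁ with hLdef
  set l := Real.log (1 + (d₂ : ℝ) / (s₂ : ℝ) ^ 2 * L) with hl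
  have hx0 : 0 ≤ (d₂ : ℝ) / (s₂ : ℝ) ^ 2 * L := by positivity
  have hl0 : 0 ≤ l := Real.log_nonneg (by linarith)
  have hA0 : 0 ≤ A := by rw [hA]; linarith
  set b := betaRate s₂ s₁ d₂ d₁ with hb
  have hb0 : 0 ≤ b := by
    have : 0 ≤ Real.log (d₁.choose s₁ : ℝ) :=
      Real.log_nonneg (by exact_mod_cast Nat.choose_pos hsd₁)
    rw [hb, betaRate]
    split_ifs <;> positivity
  have hsig1 : 2 * (4 * A + 2880 + 320 * B) * (l + s₁ * b) ≤ (s₁ * μ / Real.sqrt s₁) ^ 2 := by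
    rw [div_pow, mul_pow, Real.sq_sqrt hs₁'.le]
    calc 2 * (4 * A + 2880 + 320 * B) * (l + s₁ * b)
        = (s₁ : ℝ) ^ 2 * (2 * (4 * A + 2880 + 320 * B) * (psiRate s₁ s₂ d₁ d₂ + b)) / s₁ := by
          rw [psiRate, ← hl]; field_simp
      _ ≤ (s₁ : ℝ) ^ 2 * μ ^ 2 / s₁ := by gcongr
  have hC : 0 ≤ 4 * A + 2880 + 320 * B := by linarith
  refine risk_testC_le hs₁ le_rfl hsd₁ hs₂ hsd₂ hμ hB hA0 (fun _ => ?_) (fun _ => le_rfl) rfl ?_ ?_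
  · rw [← hl, hA]
    gcongr
    norm_num
  · refine le_trans ?_ hsig1
    have : 0 ≤ s₁ * b := by positivity
    nlinarith
  · intro hx
    have hl1 : 1 / 2 ≤ l := half_le_log_one_add hx
    have hkey : L / s₂ ≤ 2 * (l + s₁ * b) := by
      rcases hx.eq_or_lt with hx1 | hx1
      · -- At equality the indicator in `β` vanishes, but then `L = s₂² / d₂ ≤ s₂`.
        have hLs : L ≤ s₂ := by
          have h1 : (d₂ : ℝ) * L = (s₂ : ℝ) ^ 2 := by
            have : (s₂ : ℝ) ^ 2 ≠ 0 := by positivity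
            field_simp at hx1
            linarith
          nlinarith
        have : L / s₂ ≤ 1 := div_le_one (by linarith) |>.2 hLs
        have : 0 ≤ s₁ * b := by positivity
        linarith
      · have hbeq : s₁ * b = L / s₂ - 1 / s₂ := by
          rw [hb, betaRate, if_pos hx1, log_choose_eq hsd₁, ← hLdef]
          field_simp
        have : 1 / (s₂ : ℝ) ≤ 1 := div_le_one (by linarith) |>.2 hs₂'
        have : 0 ≤ s₁ * b := by positivity
        linarith
    calc (4 * A + 2880 + 320 * B) * (L / s₂)
        ≤ (4 * A + 2880 + 320 * B) * (2 * (l + s₁ * b)) := by gcongr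
      _ ≤ _ := by linarith

lemma measurable_testA (K : ℝ) (s₂ : ℕ) {d₁ d₂ : ℕ} (h h' : ℝ) :
    Measurable (testA K s₂ h h' : Matrix (Fin d₁) (Fin d₂) ℝ → Fin 2) := by
  rw [testA_eq_testC]
  exact measurable_testC K d₁ s₂ h h'

lemma rTilde_eq_of_ne {s₁ s₂ d₁ d₂ : ℕ} (ha : rTilde s₁ s₂ d₁ d₂ ≠ phiRate s₁ s₂ d₁ d₂)
    (hb : rTilde s₁ s₂ d₁ d₂ ≠ phiRate s₂ s₁ d₂ d₁)
    (hc : rTilde s₁ s₂ d₁ d₂ ≠ psiRate s₁ s₂ d₁ d₂ + betaRate s₂ s₁ d₂ d₁) :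
    rTilde s₁ s₂ d₁ d₂ = psiRate s₂ s₁ d₂ d₁ + betaRate s₁ s₂ d₁ d₂ := by
  unfold rTilde at *
  grind

end SubmatrixDetection

theorem proposition1 :
    ∃ K : ℝ, 0 < K ∧ ∀ η : ℝ, 0 < η → η < 1 →
      ∃ C C₁ C₁' C₂ C₃ C₃' C₄ C₄' : ℝ,
        0 < C ∧ 0 < C₁ ∧ 0 < C₁' ∧ 0 < C₂ ∧ 0 < C₃ ∧ 0 < C₃' ∧ 0 < C₄ ∧ 0 < C₄' ∧
        ∀ (s₁ s₂ d₁ d₂ : ℕ) (μ : ℝ), 1 ≤ s₁ → s₁ ≤ d₁ → 1 ≤ s₂ → s₂ ≤ d₂ → 0 < μ →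
          C * separationRate s₁ s₂ d₁ d₂ ≤ μ ^ 2 →
          ∀ h₁ h₁' h₂ h₂' h₃ h₃' h₄ h₄' : ℝ,
            h₁ = C₁ * ((s₂ : ℝ) * Real.log (1 + (d₂ : ℝ) / (s₂ : ℝ) ^ 2)) →
            h₁' = C₁' * ((s₁ : ℝ) * Real.log (1 + (d₁ : ℝ) / (s₁ : ℝ) ^ 2)) →
            h₂ = C₂ → h₂' = C₂ →
            h₃ = C₃ * ((s₂ : ℝ) * Real.log (1 + (d₂ : ℝ) / (s₂ : ℝ) ^ 2 * logBinom d₁ s₁)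
              + logBinom d₁ s₁) →
            h₃' = C₃' * ((s₁ : ℝ) * Real.log (1 + (d₁ : ℝ) / (s₁ : ℝ) ^ 2 * logBinom d₂ s₂)
              + logBinom d₂ s₂) →
            h₄ = C₄ * Real.sqrt (logBinom d₁ s₁) →
            h₄' = C₄' * Real.sqrt (logBinom d₂ s₂) →
            Measurable (optimalTest K s₁ s₂ d₁ d₂ h₁ h₁' h₂ h₂' h₃ h₃' h₄ h₄') ∧
            risk s₁ s₂ (optimalTest K s₁ s₂ d₁ d₂ h₁ h₁' h₂ h₂' h₃ h₃' h₄ h₄') μ ≤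
              ENNReal.ofReal η := by
  refine ⟨8, by norm_num, fun η hη hη1 => ?_⟩
  -- Each of the two errors is made at most `exp (-B) = η / 2`.
  obtain ⟨B, hB, hBη⟩ : ∃ B : ℝ, 0 ≤ B ∧ 2 * Real.exp (-B) = η := by
    refine ⟨Real.log (2 / η), Real.log_nonneg ?_, ?_⟩
    · rw [le_div_iff₀ hη]; linarith
    · rw [Real.exp_neg, Real.exp_log (by positivity)]
      field_simp
  obtain ⟨A, hA⟩ : ∃ A : ℝ, A = 240 * (9 + B) := ⟨_, rfl⟩
  have hA0 : 0 < A := by rw [hA]; linarith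
  have hc : 0 < Real.sqrt (2 * (1 + B)) := Real.sqrt_pos.2 (by linarith)
  refine ⟨6 * (4 * A + 2880 + 320 * B), A, A, Real.sqrt (2 * (1 + B)), A, A,
    Real.sqrt (2 * (1 + B)), Real.sqrt (2 * (1 + B)), by linarith, hA0, hA0, hc, hA0, hA0, hc, hc,
    ?_⟩
  rintro s₁ s₂ d₁ d₂ μ hs₁ hsd₁ hs₂ hsd₂ hμ hsep _ _ _ _ _ _ _ _ rfl rfl rfl rfl rfl rfl rfl rfl
  have hrate : 2 * (4 * A + 2880 + 320 * B) * rTilde s₁ s₂ d₁ d₂ ≤ μ ^ 2 := by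
    refine le_trans ?_ hsep
    have := mul_le_mul_of_nonneg_left (rTilde_le_separationRate hs₁ hsd₁ hs₂ hsd₂)
      (show 0 ≤ 2 * (4 * A + 2880 + 320 * B) by linarith)
    linarith
  rw [← hBη]
  by_cases ha : rTilde s₁ s₂ d₁ d₂ = phiRate s₁ s₂ d₁ d₂
  · unfold optimalTest
    simp only [if_pos ha]
    exact ⟨measurable_testA _ _ _ _,
      risk_testA_le hs₁ hsd₁ hs₂ hsd₂ hμ.le hB hA (ha ▸ hrate)⟩
  by_cases hb : rTilde s₁ s₂ d₁ d₂ = phiRate s₂ s₁ d₂ d₁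
  · unfold optimalTest
    simp only [if_neg ha, if_pos hb]
    exact ⟨(measurable_testA _ _ _ _).comp (measurable_transpose _ _),
      (risk_comp_transpose_le (measurable_testA _ _ _ _)).trans
        (risk_testA_le hs₂ hsd₂ hs₁ hsd₁ hμ.le hB hA (hb ▸ hrate))⟩
  by_cases hc : rTilde s₁ s₂ d₁ d₂ = psiRate s₁ s₂ d₁ d₂ + betaRate s₂ s₁ d₂ d₁
  · unfold optimalTest
    simp only [if_neg ha, if_neg hb, if_pos hc]
    exact ⟨measurable_testC _ _ _ _ _,
      risk_testC_self_le hs₁ hsd₁ hs₂ hsd₂ hμ.le hB hA (hc ▸ hrate)⟩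
  · unfold optimalTest
    simp only [if_neg ha, if_neg hb, if_neg hc]
    exact ⟨(measurable_testC _ _ _ _ _).comp (measurable_transpose _ _),
      (risk_comp_transpose_le (measurable_testC _ _ _ _ _)).trans
        (risk_testC_self_le hs₂ hsd₂ hs₁ hsd₁ hμ.le hB hA (rTilde_eq_of_ne ha hb hc ▸ hrate))⟩
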